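/- Fix an arrival intensity $0<\lambda<1$, an integer $D\ge 2$, a probability law $\nu$ on $(0,\infty)$ with mean $1$, and a deterministic work-conserving service discipline. (The discipline is used by each server locally: given the sizes and residual service requirements of the jobs present, in order of arrival, it determines how the unit service speed is shared until the next arrival.) For $N\ge D$ consider $N$ identical parallel servers using this discipline. Jobs arrive as a Poisson process of rate $\lambda N$, with i.i.d. service requirements of law $\nu$; each arriving job joins the shortest queue among $D$ distinct servers chosen uniformly at random, ties being broken uniformly at random. The initial state is independent of the arrivals. Let $X^N_t\in\mathbb Z_+^N$ be the vector of queue lengths at time $t$; server $1$ is the tagged server. For $x\in\mathbb Z_+^N$ with $x(1)=k$ let $$\lambda^N(x,k)=\lambda N\sum_{i=1}^D\frac1i\,\frac{\binom{\pi_k(x)-\pi_{k+1}(x)-1}{i-1}\binom{\pi_{k+1}(x)}{D-i}}{\binom ND},\qquad \pi_j(x)=\#\{i: x(i)\ge j\},$$ which is the arrival rate to server $1$ in the configuration $x$. Let $\lambda^{k,N}_t=\lambda^N\big((k,X^N_t(2),\dots,X^N_t(N)),k\big)$ be the arrival rate to the tagged server at time $t$ when it holds $k$ jobs. 1. Suppose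 that for every $N\ge D$ the initial state is exchangeable over the servers and that the law of the initial state of the tagged server does not depend on $N$. Then for every fixed $t>0$ $$\limsup_{k\to\infty}\ \limsup_{N\to\infty}\ \big\|\lambda^{k,N}_t\big\|_{L^2}=0 .$$ In particular, if the constants $\lambda^k_t$ ($k\ge 0$) are the limiting arrival rates, i.e. $\lambda^{k,N}_t\to\lambda^k_t$ in $L^2$ as $N\to\infty$ for every $k$, then $\limsup_{k\to\infty}\lambda^k_t=0$. 2. Suppose that for every $N\ge D$ the system, and with it the tagged queue, is positive recurrent in the sense that the Markov process of the states of the $N$ servers has a stationary probability law. For each $N\ge D$ choose such a law, let $X^N_\infty$ be the queue lengths under it, and let $\lambda^{k,N}_\infty=\lambda^N\big((k,X^N_\infty(2),\dots,X^N_\infty(N)),k\big)$. Then $$\limsup_{k\to\infty}\ \limsup_{N\to\infty}\ \big\|\lambda^{k,N}_\infty\big\|_{L^2}=0 .$$ In particular, if for every $k$ the limit $\lim_{N\to\infty}\lambda^{k,N}_\infty$ exists in $L^2$ and is a constant, then $\limsup_{k\to\infty}\lim_{N\to\infty}\lambda^{k,N}_\infty=0$. -/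

import Mathlib

open MeasureTheory ProbabilityTheory Filter Topology
open scoped ENNReal

noncomputable section

namespace LoadBalancing

/-- The state of one server: the number of jobs present and, for each of them in order of
arrival, the pair (service requirement, residual service requirement). -/
abbrev QueueState : Type := Σ n : ℕ, (Fin n → ℝ × ℝ)

namespace QueueState

/-- The number of jobs present (waiting or in service). -/
def length (z : QueueState) : ℕ := z.1

/-- The service requirement of the `j`-th job. -/
def size (z : QueueState) (j : Fin z.1) : ℝ := (z.2 j).1

/-- The residual service requirement of the `j`-th job. -/
def residual (z : QueueState) (j : Fin z.1) : ℝ := (z.2 j).2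

/-- The total residual service requirement of the jobs present. -/
def workload (z : QueueState) : ℝ := ∑ j, z.residual j

/-- The jobs present are unfinished and have received a nonnegative amount of service. -/
def Valid (z : QueueState) : Prop := ∀ j, 0 < z.residual j ∧ z.residual j ≤ z.size j

/-- A new job, with service requirement `s`, joins the queue. -/
def join (z : QueueState) (s : ℝ) : QueueState :=
  ⟨z.1 + 1, Fin.snoc (α := fun _ => ℝ × ℝ) z.2 (s, s)⟩

end QueueState

/-- A work-conserving service discipline of a single server of unit speed. `serve t z` is the
state of a server that starts from `z` and works for `t` units of time without new arrivals.
FIFO, LIFO (preemptive or not), processor sharing, least attained service and shortest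
remaining processing time are examples. -/
structure Discipline where
  serve : ℝ → QueueState → QueueState
  measurable_serve : Measurable fun p : ℝ × QueueState => serve p.1 p.2
  serve_zero : ∀ z, z.Valid → serve 0 z = z
  serve_add : ∀ s t z, 0 ≤ s → 0 ≤ t → z.Valid → serve (s + t) z = serve t (serve s z)
  /-- The jobs present after `t` units of time are among those present before, in the same order;
  they are unfinished, and their residual requirements have not increased. -/
  serve_jobs : ∀ t z, 0 ≤ t → z.Valid → ∃ e : Fin (serve t z).1 ↪o Fin z.1, ∀ j,
    (serve t z).size j = z.size (e j) ∧
      0 < (serve t z).residual j ∧ (serve t z).residual j ≤ z.residual (e j)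
  /-- The server works at speed one as long as there is work. -/
  work_conserving : ∀ t z, 0 ≤ t → z.Valid → (serve t z).workload = max (z.workload - t) 0

/-- The state of a system of `N` parallel servers. -/
abbrev SystemState (N : ℕ) : Type := Fin N → QueueState

/-- The vector of queue lengths. -/
def lengths {N : ℕ} (z : SystemState N) : Fin N → ℕ := fun i => (z i).length

/-- All subsets of the finite set of permutations are measurable. -/
instance permMeasurableSpace (N : ℕ) : MeasurableSpace (Equiv.Perm (Fin N)) := ⊤

/-- The randomness attached to one arriving job: the time elapsed since the previous arrival, a
ranking of the servers, and the service requirement of the job. -/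
abbrev ArrivalData (N : ℕ) : Type := ℝ × Equiv.Perm (Fin N) × ℝ

/-- `Joins D x r j`: a job that finds the queue lengths `x` is sent to server `j`. The servers
with rank less than `D` in the ranking `r` are probed; the job goes to the one with the shortest
queue, ties being resolved by rank. For a uniformly random ranking, the probed set is a uniformly
random set of `D` servers, and ties are resolved uniformly at random. -/
def Joins {N : ℕ} (D : ℕ) (x : Fin N → ℕ) (r : Equiv.Perm (Fin N)) (j : Fin N) : Prop :=
  (r j : ℕ) < D ∧ ∀ i, (r i : ℕ) < D → x j < x i ∨ (x j = x i ∧ r j ≤ r i)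

open Classical in
/-- The state just after an arrival with ranking `r` and service requirement `s`. -/
def arrive {N : ℕ} (D : ℕ) (z : SystemState N) (r : Equiv.Perm (Fin N)) (s : ℝ) :
    SystemState N :=
  fun j => if Joins D (lengths z) r j then (z j).join s else z j

/-- The state just after the `m`-th arrival, from the initial state `z`. -/
def stateAfter {N : ℕ} (P : Discipline) (D : ℕ) (z : SystemState N) (a : ℕ → ArrivalData N) :
    ℕ → SystemState N
  | 0 => z
  | m + 1 => arrive D (fun i => P.serve (a m).1 (stateAfter P D z a m i)) (a m).2.1 (a m).2.2

/-- The time of the `m`-th arrival; the time origin for `m = 0`. -/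
def arrivalTime {N : ℕ} (a : ℕ → ArrivalData N) (m : ℕ) : ℝ := ∑ i ∈ Finset.range m, (a i).1

/-- The number of arrivals in `[0, t]`. (The set is nonempty outside a null event.) -/
def arrivalCount {N : ℕ} (a : ℕ → ArrivalData N) (t : ℝ) : ℕ :=
  sInf {m | t < arrivalTime a (m + 1)}

/-- The state at time `t`, from the initial state `z`. -/
def stateAt {N : ℕ} (P : Discipline) (D : ℕ) (t : ℝ) (z : SystemState N)
    (a : ℕ → ArrivalData N) : SystemState N :=
  fun i => P.serve (t - arrivalTime a (arrivalCount a t))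
    (stateAfter P D z a (arrivalCount a t) i)

/-- The law of the arrivals: a Poisson process of rate `lam * N`, independent uniformly random
rankings, independent service requirements with law `ν`. -/
def arrivalLaw (lam : ℝ) (N : ℕ) (ν : Measure ℝ) : Measure (ℕ → ArrivalData N) :=
  Measure.infinitePi fun _ =>
    (expMeasure (lam * N)).prod ((uniformOn (Set.univ : Set (Equiv.Perm (Fin N)))).prod ν)

/-- The law of the state at time `t`, when the initial state has law `init` and is independent of
the arrivals. -/
def systemLaw {N : ℕ} (lam : ℝ) (D : ℕ) (ν : Measure ℝ) (P : Discipline)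
    (init : Measure (SystemState N)) (t : ℝ) : Measure (SystemState N) :=
  (init.prod (arrivalLaw lam N ν)).map fun q => stateAt P D t q.1 q.2

/-- The law of a system state is invariant under permutations of the servers. -/
def Exchangeable {N : ℕ} (law : Measure (SystemState N)) : Prop :=
  ∀ g : Equiv.Perm (Fin N), law.map (fun z => z ∘ g) = law

/-- `law` is a stationary probability law of the system. -/
structure IsStationary {N : ℕ} (lam : ℝ) (D : ℕ) (ν : Measure ℝ) (P : Discipline)
    (law : Measure (SystemState N)) : Prop where
  prob : IsProbabilityMeasure law
  valid : ∀ᵐ z ∂law, ∀ i, (z i).Valid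
  invariant : ∀ t, 0 ≤ t → systemLaw lam D ν P law t = law

/-- The number of servers with queue length at least `k`. -/
def numAtLeast {N : ℕ} (x : Fin N → ℕ) (k : ℕ) : ℕ := (Finset.univ.filter fun i => k ≤ x i).card

/-- The arrival rate to server `i` when the queue lengths are `x`, on the event that server `i`
has queue length `k`; zero off this event. -/
def arrivalRate {N : ℕ} (lam : ℝ) (D : ℕ) (x : Fin N → ℕ) (i : Fin N) (k : ℕ) : ℝ :=
  if x i = k then
    lam * N * ∑ j ∈ Finset.Icc 1 D, (1 / (j : ℝ)) *
      (((numAtLeast x k - numAtLeast x (k + 1) - 1).choose (j - 1) : ℝ) *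
        ((numAtLeast x (k + 1)).choose (D - j) : ℝ) / (N.choose D : ℝ))
  else 0

/-- The state-dependent arrival rate of the tagged server (server `0` of `n + 1`) in the queue
length `k`: its arrival rate if it has `k` jobs, the other queues being as in `z`. -/
def taggedRate {n : ℕ} (lam : ℝ) (D k : ℕ) (z : SystemState (n + 1)) : ℝ :=
  arrivalRate lam D (Function.update (lengths z) 0 k) 0 k

end LoadBalancing

end

noncomputable section

namespace LoadBalancing

/-! ### Measurability of the dynamics -/

/-! Both regimes reduce to one tail estimate. If the tagged server holds `k` jobs, an arrival can
join it only if the `D - 1` other probed servers all hold at least `k` jobs. As `D ≥ 2`, the rate is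
at most `lam * D` times the proportion of servers with at least `k` jobs (`taggedRate_le`). This
proportion can be cut at one, so it dominates its square, and a bound on its mean controls the L²
norm. What must be shown is `UniformTail`: the mean number of queues of length at least `k` is at
most `ε * (n + 1)` for all `k ≥ K`, with `K` free of `n`.

At a fixed time, a queue of length at least `2 * k` either had length `k` at the start or has gained
`k` jobs. The first case is controlled by exchangeability and the common initial law of the tagged
server. In the second, the gains add up to at most the number of arrivals, whose mean is of order `N
* t`, so at most order `N * t / k` servers are concerned on average (`meanAtLeast_systemLaw_le`).

In the stationary regime, the potential of a server is its workload if it holds at least `k + 1`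
jobs, and otherwise only the work of its jobs larger than `M`. Service lowers it at speed one in
every long queue. An arrival raises it in three ways: by the job's size if the job joins a long
queue; by at most `(k + 1) * M` if the queue passes from `k` to `k + 1`; by its size if it exceeds
`M`. The job joins a long queue only if the server of rank zero is long, which has probability
`numAtLeast / N`. Stationarity over a short time then gives, for the mean number `a k` of queues of
length at least `k`, `(1 - lam) * a (k + 1) ≤ lam * D * M * (k + 1) * (a k - a (k + 1)) + lam * N *
tailMean ν M`. Dividing by `k + 1` and summing makes the differences telescope, while the left side
is multiplied by a divergent harmonic sum. As `a 0 ≤ N`, the ratio `a K / N` is small uniformly in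
`N`, once `M` is large and then `K` (`uniformTail_of_isStationary`). -/

theorem measurable_queueState_iff {β : Type*} [MeasurableSpace β] {f : QueueState → β} :
    Measurable f ↔ ∀ n, Measurable fun v : Fin n → ℝ × ℝ => f ⟨n, v⟩ := by
  constructor
  · intro h n
    refine h.comp ?_
    intro s hs
    exact (MeasurableSpace.measurableSet_iInf.1 hs) n
  · intro h s hs
    exact MeasurableSpace.measurableSet_iInf.2 fun n => h n hs

theorem measurable_mk (n : ℕ) : Measurable fun v : Fin n → ℝ × ℝ => (⟨n, v⟩ : QueueState) :=
  measurable_queueState_iff.1 measurable_id n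

theorem measurable_length : Measurable QueueState.length :=
  measurable_queueState_iff.2 fun _ => measurable_const

theorem measurable_workload : Measurable QueueState.workload := by
  refine measurable_queueState_iff.2 fun n => ?_
  have h : ∀ j : Fin n, Measurable fun v : Fin n → ℝ × ℝ => (v j).2 := fun j =>
    (measurable_pi_apply j).snd
  exact Finset.measurable_sum Finset.univ fun j _ => h j

/-- The jobs of a queue, cut or padded to `n` jobs. -/
def resize (n : ℕ) (z : QueueState) : Fin n → ℝ × ℝ :=
  fun j => if h : (j : ℕ) < z.1 then z.2 ⟨j, h⟩ else 0

theorem measurable_resize (n : ℕ) : Measurable (resize n) := by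
  refine measurable_queueState_iff.2 fun m => measurable_pi_lambda _ fun j => ?_
  by_cases h : (j : ℕ) < m
  · simp only [resize, h, dite_true]
    exact measurable_pi_apply (⟨j, h⟩ : Fin m)
  · simp only [resize, h, dite_false]
    fun_prop

theorem measurable_join : Measurable fun p : QueueState × ℝ => p.1.join p.2 := by
  -- The current length becomes a separate discrete variable, so measurability is checked at each
  -- fixed length, where the target is a single component of the sigma type.
  let F : ℕ × (QueueState × ℝ) → QueueState := fun q =>
    ⟨q.1 + 1, Fin.snoc (α := fun _ => ℝ × ℝ) (resize q.1 q.2.1) (q.2.2, q.2.2)⟩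
  have hF : Measurable F := by
    refine measurable_from_prod_countable_right fun n => ?_
    refine (measurable_mk (n + 1)).comp (measurable_pi_lambda _ fun j => ?_)
    refine Fin.lastCases ?_ (fun i => ?_) j
    · simp only [Fin.snoc_last]
      fun_prop
    · simp only [Fin.snoc_castSucc]
      exact (measurable_pi_apply i).comp ((measurable_resize n).comp measurable_fst)
  have h : (fun p : QueueState × ℝ => p.1.join p.2) = fun p => F (p.1.length, p) := by
    funext ⟨⟨n, v⟩, s⟩
    have : resize n ⟨n, v⟩ = v := by
      funext j
      simp [resize]
    simp [F, QueueState.join, QueueState.length, this]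
  rw [h]
  exact hF.comp ((measurable_length.comp measurable_fst).prodMk measurable_id)

theorem measurable_lengths {N : ℕ} : Measurable (lengths (N := N)) :=
  measurable_pi_lambda _ fun i => measurable_length.comp (measurable_pi_apply i)

theorem measurableSet_joins {N : ℕ} (D : ℕ) (j : Fin N) :
    MeasurableSet {p : SystemState N × Equiv.Perm (Fin N) | Joins D (lengths p.1) p.2 j} :=
  ((measurable_lengths.comp measurable_fst).prodMk measurable_snd)
    (MeasurableSet.of_discrete (s := {q : (Fin N → ℕ) × Equiv.Perm (Fin N) | Joins D q.1 q.2 j}))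

theorem measurable_arrive {N : ℕ} (D : ℕ) :
    Measurable fun p : SystemState N × Equiv.Perm (Fin N) × ℝ => arrive D p.1 p.2.1 p.2.2 := by
  refine measurable_pi_lambda _ fun j => ?_
  refine Measurable.ite ?_ ?_ ?_
  · exact (measurable_fst.prodMk measurable_snd.fst) (measurableSet_joins D j)
  · have hj : Measurable fun p : SystemState N × Equiv.Perm (Fin N) × ℝ => p.1 j :=
      (measurable_pi_apply j).comp measurable_fst
    exact measurable_join.comp (hj.prodMk measurable_snd.snd)
  · exact (measurable_pi_apply j).comp measurable_fst

/-- All servers work for `t` units of time without new arrivals. -/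
def serveAll {N : ℕ} (P : Discipline) (t : ℝ) (z : SystemState N) : SystemState N :=
  fun i => P.serve t (z i)

theorem measurable_serveAll {N : ℕ} (P : Discipline) :
    Measurable fun p : ℝ × SystemState N => serveAll P p.1 p.2 :=
  measurable_pi_lambda _ fun i => P.measurable_serve.comp
    (measurable_fst.prodMk ((measurable_pi_apply i).comp measurable_snd))

theorem measurable_stateAfter {N : ℕ} (P : Discipline) (D m : ℕ) :
    Measurable fun p : SystemState N × (ℕ → ArrivalData N) => stateAfter P D p.1 p.2 m := by
  induction m with
  | zero => exact measurable_fst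
  | succ m ih =>
    have ha : Measurable fun p : SystemState N × (ℕ → ArrivalData N) => p.2 m :=
      (measurable_pi_apply m).comp measurable_snd
    exact (measurable_arrive D).comp
      (((measurable_serveAll P).comp (ha.fst.prodMk ih)).prodMk ha.snd)

theorem measurable_arrivalTime {N : ℕ} (m : ℕ) :
    Measurable fun a : ℕ → ArrivalData N => arrivalTime a m := by
  unfold arrivalTime
  fun_prop

theorem measurable_arrivalCount {N : ℕ} (t : ℝ) :
    Measurable fun a : ℕ → ArrivalData N => arrivalCount a t := by
  -- `sInf ∅ = 0`: paths with no arrival after `t` fall in every sublevel set.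
  have key : ∀ (S : Set ℕ) (m : ℕ), sInf S ≤ m ↔ (∃ j ≤ m, j ∈ S) ∨ ∀ j, j ∉ S := by
    intro S m
    constructor
    · intro h
      rcases S.eq_empty_or_nonempty with rfl | hS
      · exact Or.inr fun j => by simp
      · exact Or.inl ⟨_, h, Nat.sInf_mem hS⟩
    · rintro (⟨j, hj, hS⟩ | h)
      · exact (Nat.sInf_le hS).trans hj
      · have : S = ∅ := Set.eq_empty_iff_forall_notMem.2 h
        simp [this]
  refine measurable_of_Iic fun m => ?_
  have : (fun a : ℕ → ArrivalData N => arrivalCount a t) ⁻¹' Set.Iic m =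
      (⋃ j ∈ Set.Iic m, {a | t < arrivalTime a (j + 1)}) ∪
        ⋂ j, {a | t < arrivalTime a (j + 1)}ᶜ := by
    ext a
    simpa [arrivalCount] using key {m | t < arrivalTime a (m + 1)} m
  rw [this]
  have h : ∀ j, MeasurableSet {a : ℕ → ArrivalData N | t < arrivalTime a (j + 1)} := fun j =>
    measurableSet_lt measurable_const (measurable_arrivalTime _)
  exact (MeasurableSet.biUnion (Set.to_countable _) fun j _ => h j).union
    (MeasurableSet.iInter fun j => (h j).compl)

theorem measurable_stateAt {N : ℕ} (P : Discipline) (D : ℕ) (t : ℝ) :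
    Measurable fun p : SystemState N × (ℕ → ArrivalData N) => stateAt P D t p.1 p.2 := by
  let F : ℕ × (SystemState N × (ℕ → ArrivalData N)) → SystemState N := fun q =>
    serveAll P (t - arrivalTime q.2.2 q.1) (stateAfter P D q.2.1 q.2.2 q.1)
  have hF : Measurable F := by
    refine measurable_from_prod_countable_right fun m => ?_
    exact (measurable_serveAll P).comp
      ((measurable_const.sub ((measurable_arrivalTime m).comp measurable_snd)).prodMk
        (measurable_stateAfter P D m))
  exact hF.comp (((measurable_arrivalCount t).comp measurable_snd).prodMk measurable_id)

/-! ### The arrival rate of the tagged server and the tails of the queue lengths -/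

/-- This says that `d + 1` draws without replacement from `n` all hit a set of size `m` with
probability at most `m / n`, the probability for one draw. -/
theorem mul_choose_le_mul_choose {m n : ℕ} (h : m ≤ n) (d : ℕ) :
    n * m.choose (d + 1) ≤ m * n.choose (d + 1) := by
  rcases m with _ | m
  · simp
  rcases n with _ | n
  · simp at h
  have h1 := Nat.add_one_mul_choose_eq m d
  have h2 := Nat.add_one_mul_choose_eq n d
  have h3 : m.choose d ≤ n.choose d := Nat.choose_le_choose d (by omega)
  refine Nat.le_of_mul_le_mul_right (c := d + 1) ?_ (Nat.succ_pos d)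
  calc (n + 1) * (m + 1).choose (d + 1) * (d + 1)
      = (n + 1) * ((m + 1) * m.choose d) := by rw [h1]; ring
    _ ≤ (n + 1) * ((m + 1) * n.choose d) := by gcongr
    _ = (m + 1) * (n + 1).choose (d + 1) * (d + 1) := by
        rw [mul_assoc (m + 1), ← h2]; ring

/-- Each tie-breaking factor `1 / j` is bounded by one; Vandermonde's identity sums the rest. -/
theorem sum_inv_mul_choose_le (p b d : ℕ) (C : ℝ) (hC : 0 ≤ C) :
    ∑ j ∈ Finset.Icc 1 (d + 1), (1 / (j : ℝ)) *
        ((p.choose (j - 1) : ℝ) * (b.choose (d + 1 - j) : ℝ) / C) ≤ ((p + b).choose d : ℝ) / C := by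
  calc _ ≤ ∑ j ∈ Finset.Icc 1 (d + 1),
        ((p.choose (j - 1) : ℝ) * (b.choose (d + 1 - j) : ℝ) / C) := by
        refine Finset.sum_le_sum fun j hj => mul_le_of_le_one_left (by positivity) ?_
        have : (1 : ℝ) ≤ j := by exact_mod_cast (Finset.mem_Icc.1 hj).1
        exact div_le_one_of_le₀ this (by positivity)
    _ = ((p + b).choose d : ℝ) / C := by
        have h := Finset.sum_Ico_add' (fun j => (p.choose (j - 1) : ℝ) * (b.choose (d + 1 - j) : ℝ))
          0 (d + 1) 1
        have hI : Finset.Icc 1 (d + 1) = Finset.Ico (0 + 1) (d + 1 + 1) := by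
          ext j
          simp only [Finset.mem_Icc, Finset.mem_Ico]
          omega
        rw [← Finset.sum_div, Nat.add_choose_eq, Finset.Nat.sum_antidiagonal_eq_sum_range_succ_mk,
          hI, ← h, Finset.range_eq_Ico]
        push_cast
        congr 1

theorem taggedRate_nonneg {n : ℕ} {lam : ℝ} (hlam : 0 ≤ lam) (D k : ℕ)
    (z : SystemState (n + 1)) : 0 ≤ taggedRate lam D k z := by
  unfold taggedRate arrivalRate
  split_ifs
  · positivity
  · exact le_rfl

theorem taggedRate_le {n : ℕ} (hn : 0 < n) {lam : ℝ} (hlam : 0 ≤ lam) {D : ℕ} (hD : 2 ≤ D)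
    (hDn : D ≤ n + 1) (k : ℕ) (z : SystemState (n + 1)) :
    taggedRate lam D k z ≤ lam * D * ((min (numAtLeast (lengths z) k) n : ℕ) / n) := by
  obtain ⟨d, rfl⟩ : ∃ d, D = d + 1 + 1 := ⟨D - 2, by omega⟩
  set x := Function.update (lengths z) 0 k with hx
  have hx0 : x 0 = k := by simp [hx]
  -- `c` counts the untagged servers with at least `k` jobs; the tagged one has exactly `k` in `x`,
  -- whatever its length in `z`.
  obtain ⟨c, hc⟩ : ∃ c, numAtLeast x k = c + 1 := by
    refine ⟨numAtLeast x k - 1, ?_⟩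
    have : 0 < numAtLeast x k := Finset.card_pos.2 ⟨0, by simp [hx0]⟩
    omega
  have hb : numAtLeast x (k + 1) ≤ c := by
    have : numAtLeast x (k + 1) < numAtLeast x k := by
      refine Finset.card_lt_card (Finset.ssubset_iff_subset_ne.2 ⟨fun i hi => ?_, fun h => ?_⟩)
      · simp only [Finset.mem_filter, Finset.mem_univ, true_and] at hi ⊢
        omega
      · have : (0 : Fin (n + 1)) ∈ Finset.univ.filter fun i => k ≤ x i := by simp [hx0]
        rw [← h] at this
        simp [hx0] at this
    omega
  have hcn : c ≤ n := by
    have : numAtLeast x k ≤ n + 1 := (Finset.card_le_univ _).trans (by simp)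
    omega
  have hcz : c ≤ numAtLeast (lengths z) k := by
    have : numAtLeast x k ≤ numAtLeast (lengths z) k + 1 := by
      refine (Finset.card_le_card (t := insert 0 (Finset.univ.filter fun i => k ≤ lengths z i))
        fun i hi => ?_).trans (Finset.card_insert_le _ _)
      by_cases hi0 : i = 0
      · simp [hi0]
      · simpa [hi0, hx] using hi
    omega
  have hC : (0 : ℝ) < ((n + 1).choose (d + 1 + 1) : ℝ) := by
    exact_mod_cast Nat.choose_pos hDn
  have hchoose : ((n : ℝ) + 1) * (c.choose (d + 1) : ℝ) / ((n + 1).choose (d + 1 + 1) : ℝ) ≤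
      ((d : ℝ) + 1 + 1) * (c / n) := by
    have h1 : ((n : ℝ) + 1) * n.choose (d + 1) = (n + 1).choose (d + 1 + 1) * (d + 1 + 1) := by
      exact_mod_cast Nat.add_one_mul_choose_eq n (d + 1)
    have h2 : (n : ℝ) * c.choose (d + 1) ≤ c * n.choose (d + 1) := by
      exact_mod_cast mul_choose_le_mul_choose hcn d
    have hn' : (0 : ℝ) < n := by exact_mod_cast hn
    rw [← mul_div_assoc, div_le_div_iff₀ hC hn']
    nlinarith
  have hs := sum_inv_mul_choose_le (numAtLeast x k - numAtLeast x (k + 1) - 1)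
    (numAtLeast x (k + 1)) (d + 1) _ hC.le
  have hpb : numAtLeast x k - numAtLeast x (k + 1) - 1 + numAtLeast x (k + 1) = c := by omega
  rw [hpb] at hs
  have : taggedRate lam (d + 1 + 1) k z ≤
      lam * (((n : ℝ) + 1) * (c.choose (d + 1) : ℝ) / ((n + 1).choose (d + 1 + 1) : ℝ)) := by
    unfold taggedRate arrivalRate
    rw [← hx, if_pos hx0, mul_assoc, mul_div_assoc]
    push_cast
    gcongr
  refine this.trans ?_
  rw [mul_assoc]
  refine mul_le_mul_of_nonneg_left (hchoose.trans ?_) hlam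
  push_cast
  gcongr
  exact le_min (by exact_mod_cast hcz) (by exact_mod_cast hcn)

/-! ### From tails of the queue lengths to the L² norm of the rate -/

/-- The mean number of servers with queue length at least `k`. -/
def meanAtLeast {N : ℕ} (law : Measure (SystemState N)) (k : ℕ) : ℝ≥0∞ :=
  ∫⁻ z, (numAtLeast (lengths z) k : ℝ≥0∞) ∂law

/-- The queue lengths of a typical server are tight, uniformly in the number of servers. -/
def UniformTail (law : (n : ℕ) → Measure (SystemState (n + 1))) : Prop :=
  ∀ ε : ℝ, 0 < ε → ∃ K, ∀ k, K ≤ k → ∀ᶠ n : ℕ in atTop,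
    meanAtLeast (law n) k ≤ ENNReal.ofReal (ε * (n + 1))

theorem measurable_taggedRate {n : ℕ} (lam : ℝ) (D k : ℕ) :
    Measurable fun z : SystemState (n + 1) => taggedRate lam D k z :=
  (Measurable.of_discrete
    (f := fun x : Fin (n + 1) → ℕ => arrivalRate lam D (Function.update x 0 k) 0 k)).comp
    measurable_lengths

theorem eLpNorm_taggedRate_le {n : ℕ} (hn : 0 < n) {lam : ℝ} (hlam : 0 < lam) {D : ℕ}
    (hD : 2 ≤ D) (hDn : D ≤ n + 1) (k : ℕ) (law : Measure (SystemState (n + 1))) {δ : ℝ}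
    (hδ : 0 ≤ δ)
    (h : meanAtLeast law k ≤ ENNReal.ofReal (δ ^ 2 / (2 * (lam * D) ^ 2) * (n + 1))) :
    eLpNorm (fun z => taggedRate lam D k z) 2 law ≤ ENNReal.ofReal δ := by
  have hn' : (1 : ℝ) ≤ n := by exact_mod_cast hn
  have hD' : (0 : ℝ) < D := by
    have : 0 < D := by omega
    exact_mod_cast this
  have hsq : ∀ z : SystemState (n + 1), ‖taggedRate lam D k z‖ₑ ^ (2 : ℝ) ≤
      ENNReal.ofReal ((lam * D) ^ 2 / n) * (numAtLeast (lengths z) k : ℝ≥0∞) := by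
    intro z
    have h0 := taggedRate_nonneg hlam.le D k z
    have h1 := taggedRate_le hn hlam.le hD hDn k z
    rw [Real.enorm_of_nonneg h0, ENNReal.rpow_ofNat, ← ENNReal.ofReal_pow h0,
      ← ENNReal.ofReal_natCast, ← ENNReal.ofReal_mul (by positivity)]
    refine ENNReal.ofReal_le_ofReal ?_
    set m := min (numAtLeast (lengths z) k) n with hm
    have hm1 : (m : ℝ) ≤ numAtLeast (lengths z) k := by exact_mod_cast min_le_left _ _
    have hm2 : (m : ℝ) / n ≤ 1 := by
      rw [div_le_one (by linarith)]
      exact_mod_cast min_le_right _ _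
    calc taggedRate lam D k z ^ 2 ≤ (lam * D * (m / n)) ^ 2 := by gcongr
      _ = (lam * D) ^ 2 * ((m / n) * (m / n)) := by ring
      -- One factor `m / n` is bounded by one, so that a first moment suffices. This is why the
      -- proportion was cut at one.
      _ ≤ (lam * D) ^ 2 * ((numAtLeast (lengths z) k / n) * 1) := by gcongr
      _ = _ := by ring
  have hint : ∫⁻ z, ‖taggedRate lam D k z‖ₑ ^ (2 : ℝ) ∂law ≤ ENNReal.ofReal δ ^ (2 : ℝ) := by
    calc _ ≤ ∫⁻ z, ENNReal.ofReal ((lam * D) ^ 2 / n) * (numAtLeast (lengths z) k : ℝ≥0∞) ∂law :=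
          lintegral_mono hsq
      _ = ENNReal.ofReal ((lam * D) ^ 2 / n) * meanAtLeast law k :=
          lintegral_const_mul' _ _ ENNReal.ofReal_ne_top
      _ ≤ ENNReal.ofReal ((lam * D) ^ 2 / n) *
          ENNReal.ofReal (δ ^ 2 / (2 * (lam * D) ^ 2) * (n + 1)) := by gcongr
      _ = ENNReal.ofReal (δ ^ 2 * ((n + 1) / (2 * n))) := by
          rw [← ENNReal.ofReal_mul (by positivity)]
          congr 1
          field_simp
      -- The 2 in the hypothesis absorbs `(n + 1) / n ≤ 2`.
      _ ≤ ENNReal.ofReal (δ ^ 2) := by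
          refine ENNReal.ofReal_le_ofReal (mul_le_of_le_one_right (by positivity) ?_)
          rw [div_le_one (by linarith)]
          linarith
      _ = _ := by rw [ENNReal.rpow_ofNat, ENNReal.ofReal_pow hδ]
  rw [eLpNorm_eq_lintegral_rpow_enorm_toReal (by norm_num) (by norm_num)]
  simp only [ENNReal.toReal_ofNat]
  calc _ ≤ (ENNReal.ofReal δ ^ (2 : ℝ)) ^ ((1 : ℝ) / 2) := by gcongr
    _ = ENNReal.ofReal δ := by
      rw [← ENNReal.rpow_mul]
      norm_num

theorem UniformTail.limsup_eq_zero {law : (n : ℕ) → Measure (SystemState (n + 1))}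
    (h : UniformTail law) {lam : ℝ} (hlam : 0 < lam) {D : ℕ} (hD : 2 ≤ D)
    (hprob : ∀ n, D ≤ n + 1 → IsProbabilityMeasure (law n)) :
    limsup (fun k : ℕ => limsup (fun n : ℕ =>
        eLpNorm (fun z => taggedRate lam D k z) 2 (law n)) atTop) atTop = 0 ∧
      ∀ rate : ℕ → ℝ,
        (∀ k, Tendsto (fun n : ℕ =>
          eLpNorm (fun z => taggedRate lam D k z - rate k) 2 (law n)) atTop (𝓝 0)) →
        limsup (fun k : ℕ => (rate k : EReal)) atTop = 0 := by
  have hD' : (0 : ℝ) < D := by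
    have : 0 < D := by omega
    exact_mod_cast this
  have key : ∀ δ : ℝ, 0 < δ → ∃ K, ∀ k, K ≤ k → ∀ᶠ n : ℕ in atTop,
      eLpNorm (fun z => taggedRate lam D k z) 2 (law n) ≤ ENNReal.ofReal δ := by
    intro δ hδ
    obtain ⟨K, hK⟩ := h (δ ^ 2 / (2 * (lam * D) ^ 2)) (by positivity)
    refine ⟨K, fun k hk => ?_⟩
    filter_upwards [hK k hk, eventually_ge_atTop D] with n hn hDn
    exact eLpNorm_taggedRate_le (by omega) hlam hD (by omega) k (law n) hδ.le hn
  constructor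
  · refine Tendsto.limsup_eq (ENNReal.tendsto_atTop_zero.2 fun ε hε => ?_)
    obtain ⟨δ, hδ, hδε⟩ := ENNReal.lt_iff_exists_real_btwn.1 hε |>.imp fun r hr => hr
    obtain ⟨K, hK⟩ := key δ (by simpa using hδε.1)
    exact ⟨K, fun k hk => (limsup_le_of_le (h := hK k hk)).trans hδε.2.le⟩
  · intro rate hrate
    have hlim : Tendsto rate atTop (𝓝 0) := by
      refine Metric.tendsto_atTop.2 fun ε hε => ?_
      obtain ⟨K, hK⟩ := key (ε / 2) (by positivity)
      refine ⟨K, fun k hk => ?_⟩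
      -- Triangle inequality in L²: under a probability law, the norm of the constant `rate k` is
      -- its absolute value.
      have hle : ‖rate k‖ₑ ≤ ENNReal.ofReal (ε / 2) := by
        have ht : Tendsto (fun n => ENNReal.ofReal (ε / 2) +
            eLpNorm (fun z => taggedRate lam D k z - rate k) 2 (law n)) atTop
            (𝓝 (ENNReal.ofReal (ε / 2) + 0)) := tendsto_const_nhds.add (hrate k)
        rw [add_zero] at ht
        refine ge_of_tendsto ht ?_
        filter_upwards [hK k hk, eventually_ge_atTop D] with n hn hDn
        have := hprob n (by omega)
        have hm := (measurable_taggedRate (n := n) lam D k).aestronglyMeasurable (μ := law n)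
        calc ‖rate k‖ₑ = eLpNorm (fun _ : SystemState (n + 1) => rate k) 2 (law n) := by
              rw [eLpNorm_const _ (by norm_num) (IsProbabilityMeasure.ne_zero _)]
              simp
          _ = eLpNorm ((fun z => taggedRate lam D k z) -
                fun z => taggedRate lam D k z - rate k) 2 (law n) := by
              congr 1
              funext z
              simp
          _ ≤ _ := eLpNorm_sub_le hm (hm.sub aestronglyMeasurable_const) (by norm_num)
          _ ≤ _ := by gcongr
      rw [dist_zero_right]
      rw [← ofReal_norm, ENNReal.ofReal_le_ofReal_iff (by positivity)] at hle
      linarith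
    have := (continuous_coe_real_ereal.tendsto 0).comp hlim
    exact Tendsto.limsup_eq this

/-! ### The arrival process -/

theorem expMeasure_Iic_le {r : ℝ} (hr : 0 < r) {t : ℝ} (ht : 0 ≤ t) :
    expMeasure r (Set.Iic t) ≤ ENNReal.ofReal (r * t) := by
  have := isProbabilityMeasure_expMeasure hr
  rw [← ofReal_cdf, cdf_expMeasure_eq hr, if_pos ht]
  refine ENNReal.ofReal_le_ofReal ?_
  linarith [Real.add_one_le_exp (-(r * t))]

theorem ae_expMeasure_pos {r : ℝ} (hr : 0 < r) : ∀ᵐ s ∂(expMeasure r), 0 < s := by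
  have h := expMeasure_Iic_le hr le_rfl
  rw [mul_zero, ENNReal.ofReal_zero, nonpos_iff_eq_zero] at h
  rw [ae_iff]
  convert h using 2
  ext s
  simp

theorem lintegral_exp_neg_mul_expMeasure {r θ : ℝ} (hr : 0 < r) (hθ : 0 < θ) :
    ∫⁻ x, ENNReal.ofReal (Real.exp (-θ * x)) ∂(expMeasure r) = ENNReal.ofReal (r / (r + θ)) := by
  have h0 : Measurable (gammaPDF 1 r) := (measurable_gammaPDFReal 1 r).ennreal_ofReal
  have h1 : expMeasure r = volume.withDensity (gammaPDF 1 r) := rfl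
  rw [h1, lintegral_withDensity_eq_lintegral_mul _ h0 (by fun_prop)]
  have h2 : ∀ x, (gammaPDF 1 r * fun x => ENNReal.ofReal (Real.exp (-θ * x))) x =
      ENNReal.ofReal (r / (r + θ)) * exponentialPDF (r + θ) x := by
    intro x
    change exponentialPDF r x * ENNReal.ofReal (Real.exp (-θ * x)) = _
    rw [exponentialPDF_eq, exponentialPDF_eq]
    split_ifs
    · rw [← ENNReal.ofReal_mul (by positivity), ← ENNReal.ofReal_mul (by positivity), mul_assoc,
        ← Real.exp_add, ← mul_assoc, div_mul_cancel₀ _ (by positivity)]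
      congr 3
      ring
    · simp
  simp_rw [h2]
  rw [lintegral_const_mul' _ _ ENNReal.ofReal_ne_top,
    lintegral_exponentialPDF_eq_one (by positivity), mul_one]

theorem integrable_exp_neg_mul_expMeasure {r θ : ℝ} (hr : 0 < r) (hθ : 0 < θ) :
    Integrable (fun x => Real.exp (-θ * x)) (expMeasure r) := by
  refine ⟨by fun_prop, ?_⟩
  rw [hasFiniteIntegral_iff_ofReal (ae_of_all _ fun x => (Real.exp_pos _).le),
    lintegral_exp_neg_mul_expMeasure hr hθ]
  exact ENNReal.ofReal_lt_top

theorem mgf_expMeasure_neg {r θ : ℝ} (hr : 0 < r) (hθ : 0 < θ) :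
    mgf id (expMeasure r) (-θ) = r / (r + θ) := by
  rw [mgf, integral_eq_lintegral_of_nonneg_ae (ae_of_all _ fun x => (Real.exp_pos _).le)
    (by fun_prop)]
  simp only [id]
  rw [lintegral_exp_neg_mul_expMeasure hr hθ, ENNReal.toReal_ofReal (by positivity)]

/-- The law of the randomness attached to one arriving job. -/
def jobLaw (lam : ℝ) (N : ℕ) (ν : Measure ℝ) : Measure (ArrivalData N) :=
  (expMeasure (lam * N)).prod ((uniformOn (Set.univ : Set (Equiv.Perm (Fin N)))).prod ν)

instance (N : ℕ) : IsProbabilityMeasure (uniformOn (Set.univ : Set (Equiv.Perm (Fin N)))) :=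
  isProbabilityMeasure_uniformOn Set.finite_univ Set.univ_nonempty

section

variable {lam : ℝ} {N : ℕ} (ν : Measure ℝ) [IsProbabilityMeasure ν]

theorem isProbabilityMeasure_jobLaw (h : 0 < lam * N) : IsProbabilityMeasure (jobLaw lam N ν) := by
  have := isProbabilityMeasure_expMeasure h
  unfold jobLaw
  infer_instance

theorem isProbabilityMeasure_arrivalLaw (h : 0 < lam * N) :
    IsProbabilityMeasure (arrivalLaw lam N ν) := by
  have := isProbabilityMeasure_jobLaw ν h
  change IsProbabilityMeasure (Measure.infinitePi fun _ => jobLaw lam N ν)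
  infer_instance

theorem measurePreserving_job (h : 0 < lam * N) (m : ℕ) :
    MeasurePreserving (fun a : ℕ → ArrivalData N => a m) (arrivalLaw lam N ν)
      (jobLaw lam N ν) := by
  have := isProbabilityMeasure_jobLaw ν h
  exact measurePreserving_eval_infinitePi (fun _ : ℕ => jobLaw lam N ν) m

theorem measurePreserving_interarrival (h : 0 < lam * N) (m : ℕ) :
    MeasurePreserving (fun a : ℕ → ArrivalData N => (a m).1) (arrivalLaw lam N ν)
      (expMeasure (lam * N)) := by
  have := isProbabilityMeasure_expMeasure h
  have h2 : MeasurePreserving (Prod.fst : ArrivalData N → ℝ) (jobLaw lam N ν)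
      (expMeasure (lam * N)) := measurePreserving_fst
  exact h2.comp (measurePreserving_job ν h m)

theorem ae_arrivalLaw_pos (h : 0 < lam * N) (hν : ∀ᵐ s ∂ν, 0 < s) :
    ∀ᵐ a ∂(arrivalLaw lam N ν), ∀ m, 0 < (a m).1 ∧ 0 < (a m).2.2 := by
  have := isProbabilityMeasure_expMeasure h
  refine ae_all_iff.2 fun m => ?_
  refine (measurePreserving_job ν h m).quasiMeasurePreserving.ae
    (p := fun p : ArrivalData N => 0 < p.1 ∧ 0 < p.2.2) ?_
  refine Filter.Eventually.and ?_ ?_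
  · exact Measure.quasiMeasurePreserving_fst.ae (ae_expMeasure_pos h)
  · exact Measure.quasiMeasurePreserving_snd.ae (p := fun q : Equiv.Perm (Fin N) × ℝ => 0 < q.2)
      (Measure.quasiMeasurePreserving_snd.ae hν)

theorem iIndepFun_interarrival (h : 0 < lam * N) :
    iIndepFun (fun (m : ℕ) (a : ℕ → ArrivalData N) => (a m).1) (arrivalLaw lam N ν) := by
  have := isProbabilityMeasure_jobLaw ν h
  exact iIndepFun_infinitePi (P := fun _ : ℕ => jobLaw lam N ν)
    (X := fun (_ : ℕ) (p : ArrivalData N) => p.1) fun _ => measurable_fst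

theorem arrivalLaw_two_le (h : 0 < lam * N) {t : ℝ} (ht : 0 ≤ t) :
    arrivalLaw lam N ν {a | (a 0).1 ≤ t ∧ (a 1).1 ≤ t} ≤ ENNReal.ofReal ((lam * N * t) ^ 2) := by
  have hi := (iIndepFun_interarrival ν h).indepFun (i := 0) (j := 1) (by norm_num)
  have h2 := hi.measure_inter_preimage_eq_mul (Set.Iic t) (Set.Iic t) measurableSet_Iic
    measurableSet_Iic
  have hset : {a : ℕ → ArrivalData N | (a 0).1 ≤ t ∧ (a 1).1 ≤ t} =
      (fun a : ℕ → ArrivalData N => (a 0).1) ⁻¹' Set.Iic t ∩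
        (fun a : ℕ → ArrivalData N => (a 1).1) ⁻¹' Set.Iic t := rfl
  rw [hset, h2, (measurePreserving_interarrival ν h 0).measure_preimage
    measurableSet_Iic.nullMeasurableSet, (measurePreserving_interarrival ν h 1).measure_preimage
    measurableSet_Iic.nullMeasurableSet, pow_two, ENNReal.ofReal_mul (by positivity)]
  gcongr <;> exact expMeasure_Iic_le h ht

/-- Chernoff's bound for a sum of independent exponential variables, with their Laplace transform at
`θ`. -/
theorem arrivalLaw_arrivalTime_le (h : 0 < lam * N) {θ : ℝ} (hθ : 0 < θ) (t : ℝ) (m : ℕ) :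
    arrivalLaw lam N ν {a | arrivalTime a m ≤ t} ≤
      ENNReal.ofReal (Real.exp (θ * t) * (lam * N / (lam * N + θ)) ^ m) := by
  have := isProbabilityMeasure_arrivalLaw ν h
  have hi := iIndepFun_interarrival ν h
  have hmeas : ∀ m : ℕ, Measurable fun a : ℕ → ArrivalData N => (a m).1 := fun m =>
    (measurable_pi_apply m).fst
  have hsum : (∑ i ∈ Finset.range m, fun a : ℕ → ArrivalData N => (a i).1) =
      fun a => arrivalTime a m := by
    funext a
    simp [arrivalTime]
  have hint := hi.integrable_exp_mul_sum (t := -θ) hmeas (s := Finset.range m) fun i _ =>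
    (measurePreserving_interarrival ν h i).integrable_comp_of_integrable
      (integrable_exp_neg_mul_expMeasure h hθ)
  have hmgf := hi.mgf_sum (t := -θ) hmeas (Finset.range m)
  have hone : ∀ i, mgf (fun a : ℕ → ArrivalData N => (a i).1) (arrivalLaw lam N ν) (-θ) =
      lam * N / (lam * N + θ) := by
    intro i
    have hp := measurePreserving_interarrival ν h i
    rw [← mgf_expMeasure_neg h hθ, ← hp.map_eq, mgf_map hp.aemeasurable]
    · rfl
    · fun_prop
  rw [hsum] at hint hmgf
  have hch := measure_le_le_exp_mul_mgf t (by linarith) hint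
  rw [hmgf, Finset.prod_congr rfl fun i _ => hone i, Finset.prod_const, Finset.card_range,
    neg_neg] at hch
  rw [← ofReal_measureReal]
  exact ENNReal.ofReal_le_ofReal hch

end

theorem arrivalTime_arrivalCount_le {N : ℕ} (a : ℕ → ArrivalData N) {t : ℝ} (ht : 0 ≤ t) :
    arrivalTime a (arrivalCount a t) ≤ t := by
  rcases hc : arrivalCount a t with _ | c
  · simpa [arrivalTime] using ht
  · have : c ∉ {m | t < arrivalTime a (m + 1)} := Nat.notMem_of_lt_sInf (by
      change c < arrivalCount a t
      omega)
    simpa using this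

theorem arrivalTime_le_of_lt_arrivalCount {N : ℕ} (a : ℕ → ArrivalData N) {t : ℝ} {m : ℕ}
    (h : m < arrivalCount a t) : arrivalTime a (m + 1) ≤ t := by
  have : m ∉ {m | t < arrivalTime a (m + 1)} := Nat.notMem_of_lt_sInf h
  simpa using this

/-- The count is at most the number of arrival times in `[0, t]`. With `θ = 1 / t`, the Chernoff
bounds form a geometric series whose sum is `exp 1 * (lam * N * t)`. The factor `exp 1` is harmless:
only linearity in `N` is used. -/
theorem lintegral_arrivalCount_le {lam : ℝ} {N : ℕ} (ν : Measure ℝ) [IsProbabilityMeasure ν]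
    (h : 0 < lam * N) {t : ℝ} (ht : 0 < t) :
    ∫⁻ a, (arrivalCount a t : ℝ≥0∞) ∂(arrivalLaw lam N ν) ≤
      ENNReal.ofReal (Real.exp 1 * (lam * N * t)) := by
  set q := lam * N / (lam * N + 1 / t) with hq
  have hq0 : 0 ≤ q := by positivity
  have hq1 : q < 1 := by
    rw [hq, div_lt_one (by positivity)]
    have : 0 < 1 / t := by positivity
    linarith
  have hS : ∀ m, MeasurableSet {a : ℕ → ArrivalData N | arrivalTime a (m + 1) ≤ t} := fun m =>
    measurableSet_le (measurable_arrivalTime _) measurable_const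
  have hle : ∀ a : ℕ → ArrivalData N, (arrivalCount a t : ℝ≥0∞) ≤
      ∑' m, {a : ℕ → ArrivalData N | arrivalTime a (m + 1) ≤ t}.indicator 1 a := by
    intro a
    calc (arrivalCount a t : ℝ≥0∞) = ∑ m ∈ Finset.range (arrivalCount a t), (1 : ℝ≥0∞) := by simp
      _ ≤ ∑ m ∈ Finset.range (arrivalCount a t),
          {a : ℕ → ArrivalData N | arrivalTime a (m + 1) ≤ t}.indicator 1 a := by
          refine Finset.sum_le_sum fun m hm => ?_
          rw [Set.indicator_of_mem]
          · rfl
          · exact arrivalTime_le_of_lt_arrivalCount a (Finset.mem_range.1 hm)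
      _ ≤ _ := ENNReal.sum_le_tsum _
  calc _ ≤ ∫⁻ a, ∑' m, {a : ℕ → ArrivalData N | arrivalTime a (m + 1) ≤ t}.indicator 1 a
        ∂(arrivalLaw lam N ν) := lintegral_mono hle
    _ = ∑' m, arrivalLaw lam N ν {a | arrivalTime a (m + 1) ≤ t} := by
        rw [lintegral_tsum fun m => (measurable_one.indicator (hS m)).aemeasurable]
        exact tsum_congr fun m => lintegral_indicator_one (hS m)
    _ ≤ ∑' m : ℕ, ENNReal.ofReal (Real.exp 1 * q ^ (m + 1)) := by
        refine ENNReal.tsum_le_tsum fun m => ?_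
        have := arrivalLaw_arrivalTime_le ν h (θ := 1 / t) (by positivity) t (m + 1)
        rwa [one_div_mul_cancel ht.ne'] at this
    _ = ENNReal.ofReal (Real.exp 1 * (lam * N * t)) := by
        have hs : HasSum (fun m : ℕ => Real.exp 1 * q ^ (m + 1))
            (Real.exp 1 * (q * (1 - q)⁻¹)) := by
          simp only [pow_succ']
          exact ((hasSum_geometric_of_lt_one hq0 hq1).mul_left q).mul_left _
        rw [← ENNReal.ofReal_tsum_of_nonneg (fun m => by positivity) hs.summable, hs.tsum_eq]
        congr 2
        have : 1 - q = (1 / t) / (lam * N + 1 / t) := by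
          rw [hq]
          field_simp
          ring
        rw [this, hq, inv_div, div_mul_div_comm, mul_comm (lam * N), mul_div_mul_left _ _
          (by positivity)]
        field_simp

/-! ### Service and arrivals -/

theorem Discipline.length_serve_le (P : Discipline) {t : ℝ} {z : QueueState} (ht : 0 ≤ t)
    (hz : z.Valid) : (P.serve t z).length ≤ z.length := by
  obtain ⟨e, -⟩ := P.serve_jobs t z ht hz
  simpa [QueueState.length] using Fintype.card_le_of_embedding e.toEmbedding

theorem Discipline.valid_serve (P : Discipline) {t : ℝ} {z : QueueState} (ht : 0 ≤ t)
    (hz : z.Valid) : (P.serve t z).Valid := by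
  obtain ⟨e, he⟩ := P.serve_jobs t z ht hz
  intro j
  obtain ⟨h1, h2, h3⟩ := he j
  exact ⟨h2, h3.trans ((hz (e j)).2.trans_eq h1.symm)⟩

theorem QueueState.Valid.join {z : QueueState} (hz : z.Valid) {s : ℝ} (hs : 0 < s) :
    (z.join s).Valid := by
  intro j
  change Fin (z.1 + 1) at j
  refine Fin.lastCases ?_ (fun i => ?_) j
  · simpa [QueueState.join, QueueState.residual, QueueState.size] using hs
  · simpa [QueueState.join, QueueState.residual, QueueState.size] using hz i

theorem Joins.unique {N D : ℕ} {x : Fin N → ℕ} {r : Equiv.Perm (Fin N)} {i j : Fin N}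
    (hi : Joins D x r i) (hj : Joins D x r j) : i = j := by
  have h1 := hi.2 j hj.1
  have h2 := hj.2 i hi.1
  have : r i = r j := by
    rcases h1 with h1 | h1 <;> rcases h2 with h2 | h2
    · omega
    · omega
    · omega
    · exact le_antisymm h1.2 h2.2
  exact r.injective this

open Classical in
theorem sum_joins_le {N D : ℕ} (x : Fin N → ℕ) (r : Equiv.Perm (Fin N)) :
    ∑ i, (if Joins D x r i then 1 else 0) ≤ 1 := by
  rw [← Finset.card_filter, Finset.card_le_one]
  intro i hi j hj
  exact Joins.unique (Finset.mem_filter.1 hi).2 (Finset.mem_filter.1 hj).2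

theorem valid_arrive {N : ℕ} (D : ℕ) {z : SystemState N} (hz : ∀ i, (z i).Valid)
    (r : Equiv.Perm (Fin N)) {s : ℝ} (hs : 0 < s) (i : Fin N) : (arrive D z r s i).Valid := by
  unfold arrive
  split_ifs
  · exact (hz i).join hs
  · exact hz i

theorem valid_stateAfter {N : ℕ} (P : Discipline) (D : ℕ) {z : SystemState N}
    (hz : ∀ i, (z i).Valid) {a : ℕ → ArrivalData N} (ha : ∀ m, 0 < (a m).1 ∧ 0 < (a m).2.2)
    (m : ℕ) : ∀ i, (stateAfter P D z a m i).Valid := by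
  induction m with
  | zero => exact hz
  | succ m ih =>
    exact valid_arrive D (fun i => P.valid_serve (ha m).1.le (ih i)) _ (ha m).2

/-- Service never lengthens a queue and an arrival lengthens at most one. The truncated subtraction
keeps only the gains, so departures elsewhere do not matter. -/
theorem sum_length_stateAfter_le {N : ℕ} (P : Discipline) (D : ℕ) {z : SystemState N}
    (hz : ∀ i, (z i).Valid) {a : ℕ → ArrivalData N} (ha : ∀ m, 0 < (a m).1 ∧ 0 < (a m).2.2)
    (m : ℕ) : ∑ i, ((stateAfter P D z a m i).length - (z i).length) ≤ m := by
  classical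
  induction m with
  | zero => simp [stateAfter]
  | succ m ih =>
    set y : SystemState N := fun i => P.serve (a m).1 (stateAfter P D z a m i) with hy
    have h1 : ∀ i, (arrive D y (a m).2.1 (a m).2.2 i).length ≤
        (y i).length + if Joins D (lengths y) (a m).2.1 i then 1 else 0 := by
      intro i
      unfold arrive
      split_ifs
      · exact le_rfl
      · exact le_rfl
    have h2 : ∀ i, (y i).length ≤ (stateAfter P D z a m i).length := fun i =>
      P.length_serve_le (ha m).1.le (valid_stateAfter P D hz ha m i)
    calc ∑ i, ((stateAfter P D z a (m + 1) i).length - (z i).length)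
        ≤ ∑ i, (((stateAfter P D z a m i).length - (z i).length) +
            if Joins D (lengths y) (a m).2.1 i then 1 else 0) := by
          refine Finset.sum_le_sum fun i _ => ?_
          have h3 := h1 i
          have h4 := h2 i
          change (arrive D y (a m).2.1 (a m).2.2 i).length - (z i).length ≤ _
          omega
      _ ≤ m + 1 := by
          rw [Finset.sum_add_distrib]
          exact Nat.add_le_add ih (sum_joins_le _ _)

theorem sum_length_stateAt_le {N : ℕ} (P : Discipline) (D : ℕ) {z : SystemState N}
    (hz : ∀ i, (z i).Valid) {a : ℕ → ArrivalData N} (ha : ∀ m, 0 < (a m).1 ∧ 0 < (a m).2.2)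
    {t : ℝ} (ht : 0 ≤ t) :
    ∑ i, ((stateAt P D t z a i).length - (z i).length) ≤ arrivalCount a t := by
  refine le_trans (Finset.sum_le_sum fun i _ => ?_)
    (sum_length_stateAfter_le P D hz ha (arrivalCount a t))
  exact Nat.sub_le_sub_right (P.length_serve_le
    (sub_nonneg.2 (arrivalTime_arrivalCount_le a ht)) (valid_stateAfter P D hz ha _ i)) _

theorem numAtLeast_eq_sum {N : ℕ} (x : Fin N → ℕ) (k : ℕ) :
    numAtLeast x k = ∑ i, if k ≤ x i then 1 else 0 :=
  Finset.card_filter _ _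

theorem numAtLeast_anti {N : ℕ} (x : Fin N → ℕ) : Antitone (numAtLeast x) := fun _ _ h =>
  Finset.card_le_card fun i hi => by
    simp only [Finset.mem_filter, Finset.mem_univ, true_and] at hi ⊢
    omega

theorem numAtLeast_le {N : ℕ} (x : Fin N → ℕ) (k : ℕ) : numAtLeast x k ≤ N :=
  (Finset.card_le_univ _).trans (by simp)

theorem meanAtLeast_anti {N : ℕ} (law : Measure (SystemState N)) : Antitone (meanAtLeast law) :=
  fun _ _ h => lintegral_mono fun _ => by
    gcongr
    exact numAtLeast_anti _ h

theorem mul_numAtLeast_le {N : ℕ} (x y : Fin N → ℕ) (k : ℕ) :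
    k * numAtLeast y (2 * k) ≤ k * numAtLeast x k + ∑ i, (y i - x i) := by
  rw [numAtLeast_eq_sum, numAtLeast_eq_sum, Finset.mul_sum, Finset.mul_sum,
    ← Finset.sum_add_distrib]
  refine Finset.sum_le_sum fun i _ => ?_
  split_ifs <;> omega

/-! ### Uniform tails at a fixed time -/

/-- Expectation of `mul_numAtLeast_le`, divided by `k`, with the total gain bounded by the number of
arrivals. -/
theorem meanAtLeast_systemLaw_le {lam : ℝ} {N : ℕ} (h : 0 < lam * N) (D : ℕ) (ν : Measure ℝ)
    [IsProbabilityMeasure ν] (hν : ∀ᵐ s ∂ν, 0 < s) (P : Discipline)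
    (init : Measure (SystemState N)) [IsProbabilityMeasure init]
    (hinit : ∀ᵐ z ∂init, ∀ i, (z i).Valid) {t : ℝ} (ht : 0 < t) {k : ℕ} (hk : 0 < k) :
    meanAtLeast (systemLaw lam D ν P init t) (2 * k) ≤
      meanAtLeast init k + ENNReal.ofReal (Real.exp 1 * (lam * N * t) / k) := by
  have := isProbabilityMeasure_arrivalLaw ν h
  have hk0 : (k : ℝ≥0∞) ≠ 0 := by exact_mod_cast hk.ne'
  have hkt : (k : ℝ≥0∞) ≠ ⊤ := ENNReal.natCast_ne_top k
  have hae : ∀ᵐ q ∂(init.prod (arrivalLaw lam N ν)),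
      (numAtLeast (lengths (stateAt P D t q.1 q.2)) (2 * k) : ℝ≥0∞) ≤
        (numAtLeast (lengths q.1) k : ℝ≥0∞) + (k : ℝ≥0∞)⁻¹ * arrivalCount q.2 t := by
    filter_upwards [Measure.quasiMeasurePreserving_fst.ae hinit,
      Measure.quasiMeasurePreserving_snd.ae (ae_arrivalLaw_pos ν h hν)] with q hz ha
    have h1 := (mul_numAtLeast_le (lengths q.1) (lengths (stateAt P D t q.1 q.2)) k).trans
      (Nat.add_le_add_left (sum_length_stateAt_le P D hz ha ht.le) _)
    have h2 : (k : ℝ≥0∞) * numAtLeast (lengths (stateAt P D t q.1 q.2)) (2 * k) ≤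
        k * numAtLeast (lengths q.1) k + arrivalCount q.2 t := by exact_mod_cast h1
    calc (numAtLeast (lengths (stateAt P D t q.1 q.2)) (2 * k) : ℝ≥0∞)
        = (k : ℝ≥0∞)⁻¹ * (k * numAtLeast (lengths (stateAt P D t q.1 q.2)) (2 * k)) := by
          rw [← mul_assoc, ENNReal.inv_mul_cancel hk0 hkt, one_mul]
      _ ≤ (k : ℝ≥0∞)⁻¹ * (k * numAtLeast (lengths q.1) k + arrivalCount q.2 t) := by gcongr
      _ = _ := by rw [mul_add, ← mul_assoc, ENNReal.inv_mul_cancel hk0 hkt, one_mul]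
  have hmeas : Measurable fun q : SystemState N × (ℕ → ArrivalData N) =>
      (numAtLeast (lengths q.1) k : ℝ≥0∞) :=
    (Measurable.of_discrete (f := fun x : Fin N → ℕ => (numAtLeast x k : ℝ≥0∞))).comp
      (measurable_lengths.comp measurable_fst)
  have hcount : Measurable fun a : ℕ → ArrivalData N => (arrivalCount a t : ℝ≥0∞) :=
    (Measurable.of_discrete (f := fun m : ℕ => (m : ℝ≥0∞))).comp (measurable_arrivalCount t)
  calc meanAtLeast (systemLaw lam D ν P init t) (2 * k)
      ≤ ∫⁻ q, (numAtLeast (lengths (stateAt P D t q.1 q.2)) (2 * k) : ℝ≥0∞)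
          ∂(init.prod (arrivalLaw lam N ν)) := lintegral_map_le _ _
    _ ≤ ∫⁻ q, ((numAtLeast (lengths q.1) k : ℝ≥0∞) + (k : ℝ≥0∞)⁻¹ * arrivalCount q.2 t)
          ∂(init.prod (arrivalLaw lam N ν)) := lintegral_mono_ae hae
    _ = meanAtLeast init k +
          (k : ℝ≥0∞)⁻¹ * ∫⁻ a, (arrivalCount a t : ℝ≥0∞) ∂(arrivalLaw lam N ν) := by
        rw [lintegral_add_left hmeas, lintegral_const_mul' _ _ (ENNReal.inv_ne_top.2 hk0)]
        congr 1
        · exact measurePreserving_fst.lintegral_comp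
            ((Measurable.of_discrete (f := fun x : Fin N → ℕ => (numAtLeast x k : ℝ≥0∞))).comp
              measurable_lengths)
        · congr 1
          exact measurePreserving_snd.lintegral_comp hcount
    _ ≤ meanAtLeast init k +
          (k : ℝ≥0∞)⁻¹ * ENNReal.ofReal (Real.exp 1 * (lam * N * t)) := by
        gcongr
        exact lintegral_arrivalCount_le ν h ht
    _ = _ := by
        rw [ENNReal.ofReal_div_of_pos (by exact_mod_cast hk), ENNReal.ofReal_natCast,
          ENNReal.div_eq_inv_mul]

theorem meanAtLeast_eq_sum {N : ℕ} (law : Measure (SystemState N)) (k : ℕ) :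
    meanAtLeast law k = ∑ i, law {z | k ≤ (z i).length} := by
  have hS : ∀ i, MeasurableSet {z : SystemState N | k ≤ (z i).length} := fun i =>
    measurableSet_le measurable_const (measurable_length.comp (measurable_pi_apply i))
  unfold meanAtLeast
  rw [← Finset.sum_congr rfl fun i _ => lintegral_indicator_one (hS i),
    ← lintegral_finsetSum _ fun i _ => measurable_one.indicator (hS i)]
  refine lintegral_congr fun z => ?_
  rw [numAtLeast_eq_sum]
  push_cast
  refine Finset.sum_congr rfl fun i _ => ?_
  by_cases hi : k ≤ (z i).length <;> simp [hi, lengths]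

theorem Exchangeable.meanAtLeast_eq {n : ℕ} {law : Measure (SystemState (n + 1))}
    (h : Exchangeable law) (k : ℕ) :
    meanAtLeast law k = (n + 1) * law.map (fun z => z 0) {y | k ≤ y.length} := by
  have hT : MeasurableSet {y : QueueState | k ≤ y.length} :=
    measurableSet_le measurable_const measurable_length
  rw [meanAtLeast_eq_sum, Finset.sum_congr rfl (g := fun _ =>
    law.map (fun z => z 0) {y | k ≤ y.length})]
  · simp
  · intro i _
    have hg : Measurable fun z : SystemState (n + 1) => z ∘ Equiv.swap 0 i :=
      measurable_pi_lambda _ fun j => measurable_pi_apply _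
    rw [Measure.map_apply (measurable_pi_apply 0) hT]
    conv_rhs => rw [← h (Equiv.swap 0 i)]
    rw [Measure.map_apply hg (measurable_pi_apply 0 hT)]
    congr 1

theorem tendsto_measure_length_ge (μ : Measure QueueState) [IsFiniteMeasure μ] :
    Tendsto (fun k : ℕ => μ {y | k ≤ y.length}) atTop (𝓝 0) := by
  have h := tendsto_measure_iInter_atTop (μ := μ) (s := fun k : ℕ => {y | k ≤ y.length})
    (fun k => (measurableSet_le measurable_const measurable_length).nullMeasurableSet)
    (fun k l hkl y (hy : l ≤ y.length) => hkl.trans hy) ⟨0, measure_ne_top _ _⟩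
  have h0 : ⋂ k : ℕ, {y : QueueState | k ≤ y.length} = ∅ := by
    refine Set.eq_empty_iff_forall_notMem.2 fun y hy => ?_
    have : y.length + 1 ≤ y.length := Set.mem_iInter.1 hy (y.length + 1)
    omega
  rwa [h0, measure_empty] at h

theorem uniformTail_systemLaw {lam : ℝ} (hlam : 0 < lam) (D : ℕ) (ν : Measure ℝ)
    [IsProbabilityMeasure ν] (hν : ∀ᵐ s ∂ν, 0 < s) (P : Discipline) (μ : Measure QueueState)
    (init : (n : ℕ) → Measure (SystemState (n + 1)))
    (hinit : ∀ n, D ≤ n + 1 → IsProbabilityMeasure (init n) ∧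
      (∀ᵐ z ∂(init n), ∀ i, (z i).Valid) ∧
      Exchangeable (init n) ∧ (init n).map (fun z => z 0) = μ) {t : ℝ} (ht : 0 < t) :
    UniformTail fun n => systemLaw lam D ν P (init n) t := by
  have hμ : IsProbabilityMeasure μ := by
    obtain ⟨h1, -, -, h4⟩ := hinit D (by omega)
    rw [← h4]
    exact Measure.isProbabilityMeasure_map (measurable_pi_apply 0).aemeasurable
  intro ε hε
  have hpos : 0 < ENNReal.ofReal (ε / 2) := by simpa using hε
  obtain ⟨K₁, hK₁⟩ := ENNReal.tendsto_atTop_zero.1 (tendsto_measure_length_ge μ) _ hpos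
  obtain ⟨K₂, hK₂⟩ := exists_nat_gt (Real.exp 1 * (lam * t) / (ε / 2))
  -- `K₁` handles the initial tail and `K₂` the arrivals, each up to `ε / 2` per server. The `+ 1`
  -- keeps the level positive, and the 2 comes from the doubling of the level.
  refine ⟨2 * max K₁ (K₂ + 1), fun k hk => ?_⟩
  filter_upwards [eventually_ge_atTop D] with n hn
  obtain ⟨h1, h2, h3, h4⟩ := hinit n (by omega)
  set l := max K₁ (K₂ + 1) with hl
  have hlam' : 0 < lam * (n + 1 : ℕ) := by positivity
  have hl0 : 0 < l := by omega
  have hl1 : Real.exp 1 * (lam * t) ≤ l * (ε / 2) := by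
    have : (K₂ : ℝ) ≤ l := by
      have : K₂ ≤ l := by omega
      exact_mod_cast this
    rw [div_lt_iff₀ (by positivity)] at hK₂
    nlinarith
  have hl0' : (0 : ℝ) < l := by exact_mod_cast hl0
  calc meanAtLeast (systemLaw lam D ν P (init n) t) k
      ≤ meanAtLeast (systemLaw lam D ν P (init n) t) (2 * l) := meanAtLeast_anti _ hk
    _ ≤ meanAtLeast (init n) l +
          ENNReal.ofReal (Real.exp 1 * (lam * (n + 1 : ℕ) * t) / l) :=
        meanAtLeast_systemLaw_le hlam' D ν hν P (init n) h2 ht hl0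
    _ ≤ (n + 1) * ENNReal.ofReal (ε / 2) + ENNReal.ofReal (ε / 2 * (n + 1)) := by
        rw [h3.meanAtLeast_eq, h4]
        gcongr
        · exact hK₁ l (le_max_left _ _)
        · rw [div_le_iff₀ hl0']
          push_cast
          nlinarith [mul_le_mul_of_nonneg_right hl1 (by positivity : (0 : ℝ) ≤ n + 1)]
    _ = ENNReal.ofReal (ε * (n + 1)) := by
        have : ((n : ℝ≥0∞) + 1) = ENNReal.ofReal (n + 1) := by
          rw [ENNReal.ofReal_add (by positivity) zero_le_one, ENNReal.ofReal_natCast,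
            ENNReal.ofReal_one]
        rw [this, ← ENNReal.ofReal_mul (by positivity), ← ENNReal.ofReal_add (by positivity)
          (by positivity)]
        congr 1
        ring

theorem isProbabilityMeasure_systemLaw {lam : ℝ} {N : ℕ} (h : 0 < lam * N) (D : ℕ)
    (ν : Measure ℝ) [IsProbabilityMeasure ν] (P : Discipline) (init : Measure (SystemState N))
    [IsProbabilityMeasure init] (t : ℝ) :
    IsProbabilityMeasure (systemLaw lam D ν P init t) := by
  have := isProbabilityMeasure_arrivalLaw ν h
  exact Measure.isProbabilityMeasure_map (measurable_stateAt P D t).aemeasurable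

/-! ### A potential for the work of the servers with long queues -/

namespace QueueState

/-- The residual work of the jobs with service requirement larger than `M`. -/
def bigWork (M : ℝ) (z : QueueState) : ℝ := ∑ j, if M < z.size j then z.residual j else 0

/-- The whole workload if the queue length is at least `k`, the work of the jobs larger than `M`
otherwise. -/
def potential (k : ℕ) (M : ℝ) (z : QueueState) : ℝ :=
  if k ≤ z.length then z.workload else z.bigWork M

theorem Valid.bigWork_nonneg {z : QueueState} (hz : z.Valid) (M : ℝ) : 0 ≤ z.bigWork M :=
  Finset.sum_nonneg fun j _ => by
    split_ifs
    exacts [(hz j).1.le, le_rfl]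

theorem Valid.bigWork_le_workload {z : QueueState} (hz : z.Valid) (M : ℝ) :
    z.bigWork M ≤ z.workload :=
  Finset.sum_le_sum fun j _ => by
    split_ifs
    exacts [le_rfl, (hz j).1.le]

theorem Valid.workload_le {z : QueueState} (hz : z.Valid) {M : ℝ} (hM : 0 ≤ M) :
    z.workload ≤ z.bigWork M + z.length * M := by
  have : (z.length : ℝ) * M ≥ ∑ j : Fin z.1, M := by simp [length]
  refine le_trans ?_ (add_le_add_right this _)
  rw [workload, bigWork, ← Finset.sum_add_distrib]
  refine Finset.sum_le_sum fun j _ => ?_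
  have h1 := (hz j).1
  have h2 := (hz j).2
  split_ifs with h <;> linarith

theorem Valid.potential_nonneg {z : QueueState} (hz : z.Valid) (k : ℕ) (M : ℝ) :
    0 ≤ z.potential k M := by
  unfold potential
  split_ifs
  exacts [(hz.bigWork_nonneg M).trans (hz.bigWork_le_workload M), hz.bigWork_nonneg M]

theorem workload_join (z : QueueState) (s : ℝ) : (z.join s).workload = z.workload + s := by
  refine (Fin.sum_univ_castSucc (n := z.1) fun j => (z.join s).residual j).trans ?_
  simp [join, residual, workload]

theorem bigWork_join (z : QueueState) (M s : ℝ) :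
    (z.join s).bigWork M = z.bigWork M + if M < s then s else 0 := by
  refine (Fin.sum_univ_castSucc (n := z.1) fun j =>
    if M < (z.join s).size j then (z.join s).residual j else 0).trans ?_
  simp only [join, residual, size, bigWork, Fin.snoc_castSucc, Fin.snoc_last]
  rfl

theorem length_join (z : QueueState) (s : ℝ) : (z.join s).length = z.length + 1 := rfl

/-- Only the passage from `k` to `k + 1` needs care, since the whole workload then enters the
potential. The `k` old jobs contribute at most `k * M` beyond their big work, and the new job is
either at most `M` or counted as big. -/
theorem Valid.potential_join_le {z : QueueState} (hz : z.Valid) (k : ℕ) {M : ℝ} (hM : 0 ≤ M)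
    (s : ℝ) :
    (z.join s).potential (k + 1) M ≤ z.potential (k + 1) M +
      ((if k + 1 ≤ z.length then s else 0) + (if z.length = k then (k + 1) * M else 0) +
        if M < s then s else 0) := by
  have h1 := hz.workload_le hM
  unfold potential
  rw [workload_join, bigWork_join, length_join]
  rcases lt_trichotomy z.length k with h | h | h
  · simp [show ¬ k ≤ z.length by omega, show ¬ k + 1 ≤ z.length by omega, h.ne]
  · subst h
    simp only [le_refl, add_le_iff_nonpos_right, Nat.le_zero_eq, one_ne_zero, if_true, if_false]
    split_ifs <;> linarith
  · simp only [show k + 1 ≤ z.length + 1 by omega, show k + 1 ≤ z.length by omega, h.ne', if_true,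
      if_false]
    split_ifs <;> linarith

end QueueState

/-! ### Decrease of the potential under service -/

/-- A job is big according to its original size, which service does not change; so the surviving big
jobs were big before, with no smaller residuals. -/
theorem Discipline.bigWork_serve_le (P : Discipline) {t : ℝ} {z : QueueState} (ht : 0 ≤ t)
    (hz : z.Valid) (M : ℝ) : (P.serve t z).bigWork M ≤ z.bigWork M := by
  obtain ⟨e, he⟩ := P.serve_jobs t z ht hz
  unfold QueueState.bigWork
  calc _ ≤ ∑ j, if M < z.size (e j) then z.residual (e j) else 0 := by
        refine Finset.sum_le_sum fun j _ => ?_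
        rw [(he j).1]
        split_ifs
        exacts [(he j).2.2, le_rfl]
    _ = ∑ i ∈ Finset.univ.map e.toEmbedding, if M < z.size i then z.residual i else 0 := by
        rw [Finset.sum_map]
        rfl
    _ ≤ _ := by
        refine Finset.sum_le_sum_of_subset_of_nonneg (Finset.subset_univ _) fun i _ _ => ?_
        split_ifs
        exacts [(hz i).1.le, le_rfl]

/-- A queue that is nonempty at the end has positive workload, so the maximum in work conservation
is not zero and no capacity was lost. -/
theorem Discipline.workload_serve_add (P : Discipline) {t : ℝ} {z : QueueState} (ht : 0 ≤ t)
    (hz : z.Valid) (h : 0 < (P.serve t z).length) :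
    (P.serve t z).workload + t = z.workload := by
  have hpos : 0 < (P.serve t z).workload := by
    have : Nonempty (Fin (P.serve t z).1) := ⟨⟨0, h⟩⟩
    exact Finset.sum_pos (fun j _ => (P.valid_serve ht hz j).1) Finset.univ_nonempty
  rw [P.work_conserving t z ht hz] at hpos ⊢
  rcases max_cases (z.workload - t) 0 with ⟨h1, -⟩ | ⟨h1, -⟩
  · rw [h1]
    ring
  · rw [h1] at hpos
    exact absurd hpos (lt_irrefl _)

/-- A queue still long at the end was long throughout and lost exactly `t`. If it drops below `k +
1`, the potential switches from the workload to the smaller big work. -/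
theorem Discipline.potential_serve_le (P : Discipline) {t : ℝ} {z : QueueState} (ht : 0 ≤ t)
    (hz : z.Valid) (k : ℕ) (M : ℝ) :
    (P.serve t z).potential (k + 1) M + (if k + 1 ≤ (P.serve t z).length then t else 0) ≤
      z.potential (k + 1) M := by
  have hlen := P.length_serve_le ht hz
  unfold QueueState.potential
  split_ifs with h1 h2 h2
  · exact (P.workload_serve_add ht hz (by omega)).le
  · omega
  · rw [add_zero]
    exact (P.bigWork_serve_le ht hz M).trans (hz.bigWork_le_workload M)
  · rw [add_zero]
    exact P.bigWork_serve_le ht hz M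

theorem measurable_bigWork (M : ℝ) : Measurable (QueueState.bigWork M) := by
  refine measurable_queueState_iff.2 fun n => ?_
  have h : ∀ j : Fin n, Measurable fun v : Fin n → ℝ × ℝ => if M < (v j).1 then (v j).2 else 0 :=
    fun j => Measurable.ite (measurableSet_lt measurable_const (measurable_pi_apply j).fst)
      (measurable_pi_apply j).snd measurable_const
  exact Finset.measurable_sum Finset.univ fun j _ => h j

theorem measurable_potential (k : ℕ) (M : ℝ) : Measurable (QueueState.potential k M) :=
  Measurable.ite (measurableSet_le measurable_const measurable_length) measurable_workload
    (measurable_bigWork M)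

/-- The potential of the system, truncated at `L` in each server. -/
def systemPotential {N : ℕ} (k : ℕ) (M L : ℝ) (z : SystemState N) : ℝ :=
  ∑ i, min ((z i).potential k M) L

/-- The number of servers with queue length at least `k` and workload at most `L`. -/
def numModerate {N : ℕ} (k : ℕ) (L : ℝ) (z : SystemState N) : ℕ := by
  classical
  exact ∑ i, if k ≤ (z i).length ∧ (z i).workload ≤ L then 1 else 0

theorem measurable_systemPotential {N : ℕ} (k : ℕ) (M L : ℝ) :
    Measurable (systemPotential (N := N) k M L) :=
  Finset.measurable_sum Finset.univ fun i _ =>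
    ((measurable_potential k M).comp (measurable_pi_apply i)).min measurable_const

theorem measurable_numModerate {N : ℕ} (k : ℕ) (L : ℝ) :
    Measurable (numModerate (N := N) k L) := by
  have hS : MeasurableSet {y : QueueState | k ≤ y.length ∧ y.workload ≤ L} :=
    (measurableSet_le measurable_const measurable_length).inter
      (measurableSet_le measurable_workload measurable_const)
  exact Finset.measurable_sum Finset.univ fun i _ => Measurable.ite
    (measurable_pi_apply (X := fun _ : Fin N => QueueState) i hS) measurable_const
    measurable_const

theorem numModerate_le {N : ℕ} (k : ℕ) (L : ℝ) (z : SystemState N) : numModerate k L z ≤ N := by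
  refine (Finset.sum_le_sum (g := fun _ => 1) fun i _ => ?_).trans (by simp)
  split_ifs <;> omega

theorem systemPotential_le {N : ℕ} (k : ℕ) (M L : ℝ) (z : SystemState N) :
    systemPotential k M L z ≤ N * L :=
  (Finset.sum_le_sum (g := fun _ => L) fun i _ => min_le_right _ _).trans (by simp)

theorem systemPotential_nonneg {N : ℕ} (k : ℕ) (M : ℝ) {L : ℝ} (hL : 0 ≤ L) {z : SystemState N}
    (hz : ∀ i, (z i).Valid) : 0 ≤ systemPotential k M L z :=
  Finset.sum_nonneg fun i _ => le_min ((hz i).potential_nonneg k M) hL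

open Classical in
-- The truncation is at `L + 1` while the gain is claimed only for a final workload at most `L`: as
-- `t ≤ 1`, the initial workload is then at most `L + 1`, and the truncation is inactive at both
-- ends.
theorem Discipline.min_potential_serve_le (P : Discipline) {t : ℝ} {z : QueueState} (ht : 0 ≤ t)
    (ht1 : t ≤ 1) (hz : z.Valid) (k : ℕ) (M L : ℝ) :
    min ((P.serve t z).potential (k + 1) M) (L + 1) +
        t * (if k + 1 ≤ (P.serve t z).length ∧ (P.serve t z).workload ≤ L then 1 else 0) ≤
      min (z.potential (k + 1) M) (L + 1) := by
  have h := P.potential_serve_le ht hz k M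
  by_cases h1 : k + 1 ≤ (P.serve t z).length
  · rw [if_pos h1] at h
    by_cases h2 : (P.serve t z).workload ≤ L
    · rw [if_pos ⟨h1, h2⟩, mul_one]
      have h3 : (P.serve t z).potential (k + 1) M = (P.serve t z).workload := if_pos h1
      have h4 := P.workload_serve_add ht hz (by omega)
      have h5 : z.potential (k + 1) M = z.workload :=
        if_pos (h1.trans (P.length_serve_le ht hz))
      rw [min_eq_left (by linarith), min_eq_left (by linarith)]
      exact h
    · rw [if_neg (fun h => h2 h.2), mul_zero, add_zero]
      exact min_le_min_right _ (by linarith)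
  · rw [if_neg h1, add_zero] at h
    rw [if_neg (fun h => h1 h.1), mul_zero, add_zero]
    exact min_le_min_right _ h

theorem systemPotential_serveAll_le {N : ℕ} (P : Discipline) (k : ℕ) (M L : ℝ)
    {z : SystemState N} (hz : ∀ i, (z i).Valid) {t : ℝ} (ht : 0 ≤ t) (ht1 : t ≤ 1) :
    systemPotential (k + 1) M (L + 1) (serveAll P t z) +
      t * numModerate (k + 1) L (serveAll P t z) ≤ systemPotential (k + 1) M (L + 1) z := by
  unfold systemPotential numModerate
  push_cast
  rw [Finset.mul_sum, ← Finset.sum_add_distrib]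
  refine Finset.sum_le_sum fun i _ => ?_
  exact P.min_potential_serve_le ht ht1 (hz i) k M L

theorem serveAll_valid {N : ℕ} (P : Discipline) {z : SystemState N} (hz : ∀ i, (z i).Valid)
    {t : ℝ} (ht : 0 ≤ t) (i : Fin N) : (serveAll P t z i).Valid := P.valid_serve ht (hz i)

/-! ### Growth of the potential at an arrival -/

open Classical in
/-- The number (zero or one) of servers with queue length at least `k` joined by a job that finds
the queue lengths `x`. -/
def joinsAtLeast {N : ℕ} (D k : ℕ) (x : Fin N → ℕ) (r : Equiv.Perm (Fin N)) : ℕ :=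
  ∑ i, if Joins D x r i ∧ k ≤ x i then 1 else 0

open Classical in
/-- The number (zero or one) of servers with queue length `k` joined by a job that finds the
queue lengths `x`. -/
def joinsEqual {N : ℕ} (D k : ℕ) (x : Fin N → ℕ) (r : Equiv.Perm (Fin N)) : ℕ :=
  ∑ i, if Joins D x r i ∧ x i = k then 1 else 0

/-- A bound for the growth of the potential at an arrival. -/
def jump {N : ℕ} (D k : ℕ) (M : ℝ) (x : Fin N → ℕ) (r : Equiv.Perm (Fin N)) (s : ℝ) : ℝ :=
  joinsAtLeast D (k + 1) x r * s + joinsEqual D k x r * ((k + 1) * M) + if M < s then s else 0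

theorem jump_nonneg {N : ℕ} (D k : ℕ) {M : ℝ} (hM : 0 ≤ M) (x : Fin N → ℕ)
    (r : Equiv.Perm (Fin N)) {s : ℝ} (hs : 0 ≤ s) : 0 ≤ jump D k M x r s := by
  unfold jump
  have : 0 ≤ if M < s then s else 0 := by
    split_ifs
    exacts [hs, le_rfl]
  positivity

theorem systemPotential_arrive_le {N : ℕ} (D k : ℕ) {M : ℝ} (hM : 0 ≤ M) (L : ℝ)
    {z : SystemState N} (hz : ∀ i, (z i).Valid) (r : Equiv.Perm (Fin N)) {s : ℝ} (hs : 0 ≤ s) :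
    systemPotential (k + 1) M L (arrive D z r s) ≤
      systemPotential (k + 1) M L z + jump D k M (lengths z) r s := by
  classical
  set b : ℝ := if M < s then s else 0 with hb
  have hb0 : 0 ≤ b := by
    rw [hb]
    split_ifs
    exacts [hs, le_rfl]
  have h1 : ∀ i, min ((arrive D z r s i).potential (k + 1) M) L ≤
      min ((z i).potential (k + 1) M) L +
        ((if Joins D (lengths z) r i ∧ k + 1 ≤ lengths z i then 1 else 0) * s +
          (if Joins D (lengths z) r i ∧ lengths z i = k then 1 else 0) * ((k + 1) * M) +
          (if Joins D (lengths z) r i then 1 else 0) * b) := by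
    intro i
    unfold arrive
    by_cases hj : Joins D (lengths z) r i
    · have h := (hz i).potential_join_le k hM s
      simp only [hj, true_and, if_true, ite_mul, one_mul, zero_mul]
      have h0 : ∀ x y w : ℝ, 0 ≤ w → x ≤ y + w → min x L ≤ min y L + w := by
        intro x y w hw hx
        rw [← min_add_add_right]
        exact min_le_min hx (by linarith)
      refine h0 _ _ _ ?_ h
      have : 0 ≤ if lengths z i = k then ((k : ℝ) + 1) * M else 0 := by
        split_ifs
        exacts [by positivity, le_rfl]
      have : 0 ≤ if k + 1 ≤ lengths z i then s else 0 := by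
        split_ifs
        exacts [hs, le_rfl]
      positivity
    · simp [hj]
  have h2 : (∑ i, (if Joins D (lengths z) r i then (1 : ℝ) else 0)) * b ≤ b := by
    refine mul_le_of_le_one_left hb0 ?_
    exact_mod_cast sum_joins_le (D := D) (lengths z) r
  calc systemPotential (k + 1) M L (arrive D z r s)
      ≤ ∑ i, (min ((z i).potential (k + 1) M) L +
        ((if Joins D (lengths z) r i ∧ k + 1 ≤ lengths z i then 1 else 0) * s +
          (if Joins D (lengths z) r i ∧ lengths z i = k then 1 else 0) * ((k + 1) * M) +
          (if Joins D (lengths z) r i then 1 else 0) * b)) := Finset.sum_le_sum fun i _ => h1 i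
    _ ≤ _ := by
        simp only [Finset.sum_add_distrib, ← Finset.sum_mul]
        unfold systemPotential jump joinsAtLeast joinsEqual
        push_cast
        linarith

/-! ### The potential over a short time interval -/

theorem stateAt_of_lt {N : ℕ} (P : Discipline) (D : ℕ) {t : ℝ} (z : SystemState N)
    {a : ℕ → ArrivalData N} (h : t < (a 0).1) : stateAt P D t z a = serveAll P t z := by
  have h0 : arrivalCount a t = 0 := by
    refine Nat.sInf_eq_zero.2 (Or.inl ?_)
    simpa [arrivalTime] using h
  unfold stateAt
  rw [h0]
  simp only [arrivalTime, stateAfter, Finset.range_zero, Finset.sum_empty, sub_zero]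
  rfl

theorem stateAt_of_le_of_lt {N : ℕ} (P : Discipline) (D : ℕ) {t : ℝ} (z : SystemState N)
    {a : ℕ → ArrivalData N} (h0 : (a 0).1 ≤ t) (h1 : t < (a 0).1 + (a 1).1) :
    stateAt P D t z a =
      serveAll P (t - (a 0).1) (arrive D (serveAll P (a 0).1 z) (a 0).2.1 (a 0).2.2) := by
  have hc : arrivalCount a t = 1 := by
    have hle : arrivalCount a t ≤ 1 := Nat.sInf_le (by
      simpa [arrivalTime, Finset.sum_range_succ] using h1)
    have hne : arrivalCount a t ≠ 0 := fun h => by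
      rcases Nat.sInf_eq_zero.1 h with h | h
      · have : t < (a 0).1 := by simpa [arrivalTime] using h
        linarith
      · exact Set.eq_empty_iff_forall_notMem.1 h 1 (by
          simpa [arrivalTime, Finset.sum_range_succ] using h1)
    omega
  unfold stateAt
  rw [hc]
  simp only [arrivalTime, stateAfter, Finset.range_one, Finset.sum_singleton]
  rfl

open Classical in
-- With no arrival, the full decrease is available. With exactly one, the decrease is given up at
-- cost `t * N`. With two or more, the first two interarrival times are at most `t` and the
-- potential is bounded by its maximum. The last two costs have mean of order `t ^ 2`.
theorem systemPotential_stateAt_le {N : ℕ} (P : Discipline) (D k : ℕ) {M : ℝ} (hM : 0 ≤ M)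
    {L : ℝ} (hL : 0 ≤ L) {z : SystemState N} (hz : ∀ i, (z i).Valid)
    {a : ℕ → ArrivalData N} (ha : ∀ m, 0 < (a m).1 ∧ 0 < (a m).2.2) {t : ℝ} (ht : 0 ≤ t)
    (ht1 : t ≤ 1) :
    systemPotential (k + 1) M (L + 1) (stateAt P D t z a) +
        t * numModerate (k + 1) L (stateAt P D t z a) ≤
      systemPotential (k + 1) M (L + 1) z +
        ((if (a 0).1 ≤ t then
            jump D k M (lengths (serveAll P (a 0).1 z)) (a 0).2.1 (a 0).2.2 + t * N else 0) +
          if (a 0).1 ≤ t ∧ (a 1).1 ≤ t then N * (L + 1) else 0) := by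
  have hmod : t * numModerate (k + 1) L (stateAt P D t z a) ≤ t * N := by
    gcongr
    exact_mod_cast numModerate_le _ _ _
  have hjump := jump_nonneg D k hM (lengths (serveAll P (a 0).1 z)) (a 0).2.1 (ha 0).2.le
  rcases lt_or_ge t (a 0).1 with h0 | h0
  · rw [if_neg h0.not_ge, if_neg (fun h => h0.not_ge h.1), add_zero, add_zero,
      stateAt_of_lt P D z h0]
    exact systemPotential_serveAll_le P k M L hz ht ht1
  rw [if_pos h0]
  have hnn : 0 ≤ if (a 0).1 ≤ t ∧ (a 1).1 ≤ t then (N : ℝ) * (L + 1) else 0 := by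
    split_ifs
    exacts [by positivity, le_rfl]
  rcases lt_or_ge t ((a 0).1 + (a 1).1) with h1 | h1
  · have e1 := systemPotential_serveAll_le P k M L hz (ha 0).1.le (h0.trans ht1)
    have hv := serveAll_valid P hz (ha 0).1.le
    have e2 := systemPotential_arrive_le D k hM (L + 1) hv (a 0).2.1 (ha 0).2.le
    have e3 := systemPotential_serveAll_le P k M L
      (valid_arrive D hv (a 0).2.1 (ha 0).2) (sub_nonneg.2 h0) (by linarith [(ha 0).1])
    rw [← stateAt_of_le_of_lt P D z h0 h1] at e3
    have p1 : 0 ≤ (a 0).1 * numModerate (k + 1) L (serveAll P (a 0).1 z) :=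
      mul_nonneg (ha 0).1.le (Nat.cast_nonneg _)
    have p2 : 0 ≤ (t - (a 0).1) * numModerate (k + 1) L (stateAt P D t z a) :=
      mul_nonneg (sub_nonneg.2 h0) (Nat.cast_nonneg _)
    linarith
  · rw [if_pos ⟨h0, by linarith [(ha 0).1]⟩]
    have e1 := systemPotential_le (k + 1) M (L + 1) (stateAt P D t z a)
    have e2 := systemPotential_nonneg (k + 1) M (by linarith : 0 ≤ L + 1) hz
    linarith

/-! ### The mean jump of the potential -/

theorem uniformOn_rank_eq {N : ℕ} (i j : Fin N) :
    uniformOn (Set.univ : Set (Equiv.Perm (Fin N))) {r | r i = j} = (N : ℝ≥0∞)⁻¹ := by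
  set u := uniformOn (Set.univ : Set (Equiv.Perm (Fin N))) with hu
  have hN : (N : ℝ≥0∞) ≠ 0 := by
    have := i.pos
    exact_mod_cast this.ne'
  -- Left multiplication by a transposition permutes the possible ranks of `i`.
  have hsym : ∀ l, u {r | r i = l} = u {r | r i = j} := by
    intro l
    rw [hu, uniformOn_univ, uniformOn_univ]
    congr 1
    have himg : (fun r : Equiv.Perm (Fin N) => Equiv.swap j l * r) '' {r | r i = l} =
        {r | r i = j} := by
      ext r
      constructor
      · rintro ⟨q, hq, rfl⟩
        have hq' : q i = l := hq
        simp [hq']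
      · intro hr
        have hr' : r i = j := hr
        exact ⟨Equiv.swap j l * r, by simp [hr'], by simp [← mul_assoc]⟩
    rw [← himg, Measure.count_injective_image (mul_right_injective _)]
  have hsum : ∑ l, u {r | r i = l} = 1 := by
    rw [← Finset.sum_congr rfl fun l _ => lintegral_indicator_one (μ := u)
      (MeasurableSet.of_discrete (s := {r : Equiv.Perm (Fin N) | r i = l})),
      ← lintegral_finsetSum _ fun l _ => Measurable.of_discrete]
    have : ∀ r : Equiv.Perm (Fin N),
        ∑ l, ({r : Equiv.Perm (Fin N) | r i = l}.indicator 1 r : ℝ≥0∞) = 1 := by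
      intro r
      simp [Set.indicator_apply]
    simp_rw [this]
    simp
  rw [Finset.sum_congr rfl fun l _ => hsym l, Finset.sum_const, Finset.card_univ,
    Fintype.card_fin, nsmul_eq_mul] at hsum
  exact ENNReal.eq_inv_of_mul_eq_one_left (by rwa [mul_comm])

theorem uniformOn_rank_lt {N : ℕ} (D : ℕ) (i : Fin N) :
    uniformOn (Set.univ : Set (Equiv.Perm (Fin N))) {r | (r i : ℕ) < D} ≤
      D * (N : ℝ≥0∞)⁻¹ := by
  have hsub : {r : Equiv.Perm (Fin N) | (r i : ℕ) < D} ⊆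
      ⋃ l ∈ Finset.range D, {r : Equiv.Perm (Fin N) | (r i : ℕ) = l} := by
    intro r hr
    exact Set.mem_biUnion (Finset.mem_coe.2 (Finset.mem_range.2 hr)) rfl
  refine (measure_mono hsub).trans ((measure_biUnion_finset_le _ _).trans ?_)
  refine (Finset.sum_le_sum (g := fun _ => (N : ℝ≥0∞)⁻¹) fun l _ => ?_).trans (by simp)
  by_cases hl : l < N
  · refine le_of_eq_of_le ?_ (uniformOn_rank_eq i ⟨l, hl⟩).le
    congr 1
    ext r
    simp [Fin.ext_iff]
  · have : {r : Equiv.Perm (Fin N) | (r i : ℕ) = l} = ∅ :=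
      Set.eq_empty_iff_forall_notMem.2 fun r (hr : (r i : ℕ) = l) => hl (hr ▸ (r i).2)
    simp [this]

/-- The number of servers with queue length `k`. -/
def numEqual {N : ℕ} (x : Fin N → ℕ) (k : ℕ) : ℕ := ∑ i, if x i = k then 1 else 0

theorem numEqual_add_numAtLeast {N : ℕ} (x : Fin N → ℕ) (k : ℕ) :
    numEqual x k + numAtLeast x (k + 1) = numAtLeast x k := by
  rw [numEqual, numAtLeast_eq_sum, numAtLeast_eq_sum, ← Finset.sum_add_distrib]
  refine Finset.sum_congr rfl fun i _ => ?_
  split_ifs <;> omega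

theorem lintegral_sum_ite_le {N : ℕ} (p : Fin N → Prop) [DecidablePred p]
    (S : Fin N → Set (Equiv.Perm (Fin N))) (c : ℝ≥0∞)
    (hS : ∀ i, uniformOn (Set.univ : Set (Equiv.Perm (Fin N))) (S i) ≤ c) :
    ∫⁻ r, ∑ i, (if p i then (S i).indicator 1 r else 0)
      ∂(uniformOn (Set.univ : Set (Equiv.Perm (Fin N)))) ≤ c * (∑ i, if p i then 1 else 0 : ℕ) := by
  rw [lintegral_finsetSum _ fun i _ => Measurable.of_discrete]
  push_cast
  rw [Finset.mul_sum]
  refine Finset.sum_le_sum fun i _ => ?_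
  split_ifs
  · rw [lintegral_indicator_one MeasurableSet.of_discrete, mul_one]
    exact hS i
  · simp

/-- The server of rank zero is always probed, so the job joins a long queue only if that server is
long. A union bound over the probes would give `D / N`; the exact `1 / N` is needed for the drift `1
- lam` to stay positive. -/
theorem lintegral_joinsAtLeast_le {N D : ℕ} (hD : 0 < D) (k : ℕ) (x : Fin N → ℕ) :
    ∫⁻ r, (joinsAtLeast D k x r : ℝ≥0∞) ∂(uniformOn (Set.univ : Set (Equiv.Perm (Fin N)))) ≤
      (N : ℝ≥0∞)⁻¹ * numAtLeast x k := by
  classical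
  rcases Nat.eq_zero_or_pos N with rfl | hN
  · simp [joinsAtLeast]
  rw [numAtLeast_eq_sum]
  refine le_trans (lintegral_mono fun r => ?_) (lintegral_sum_ite_le (fun i => k ≤ x i)
    (fun i => {r | r i = ⟨0, hN⟩}) _ fun i => (uniformOn_rank_eq i _).le)
  set i₀ := r.symm ⟨0, hN⟩ with hi₀
  have hr : r i₀ = ⟨0, hN⟩ := by simp [hi₀]
  have hle : joinsAtLeast D k x r ≤ if k ≤ x i₀ then 1 else 0 := by
    split_ifs with h
    · refine (Finset.sum_le_sum fun i _ => ?_).trans (sum_joins_le (D := D) x r)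
      split_ifs with h1 h2 h2
      exacts [le_rfl, absurd h1.1 h2, zero_le_one, le_rfl]
    · refine (Finset.sum_eq_zero fun i _ => if_neg ?_).le
      rintro ⟨hj, hk⟩
      rcases hj.2 i₀ (by simpa [hr] using hD) with h1 | h1 <;> omega
  calc (joinsAtLeast D k x r : ℝ≥0∞) ≤ ((if k ≤ x i₀ then 1 else 0 : ℕ) : ℝ≥0∞) := by
        exact_mod_cast hle
    _ = if k ≤ x i₀ then
          ({r | r i₀ = ⟨0, hN⟩} : Set (Equiv.Perm (Fin N))).indicator 1 r else 0 := by
        rw [Set.indicator_of_mem (show r ∈ {r : Equiv.Perm (Fin N) | r i₀ = ⟨0, hN⟩} from hr)]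
        push_cast
        rfl
    _ ≤ _ := Finset.single_le_sum (f := fun i => if k ≤ x i then
          ({r | r i = ⟨0, hN⟩} : Set (Equiv.Perm (Fin N))).indicator
            (1 : Equiv.Perm (Fin N) → ℝ≥0∞) r else 0)
          (fun i _ => zero_le) (Finset.mem_univ i₀)

/-- Here being probed is enough: the factor `D` only enlarges a constant in front of `numEqual`. -/
theorem lintegral_joinsEqual_le {N : ℕ} (D k : ℕ) (x : Fin N → ℕ) :
    ∫⁻ r, (joinsEqual D k x r : ℝ≥0∞) ∂(uniformOn (Set.univ : Set (Equiv.Perm (Fin N)))) ≤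
      D * (N : ℝ≥0∞)⁻¹ * numEqual x k := by
  classical
  refine le_trans (lintegral_mono fun r => ?_) (lintegral_sum_ite_le (fun i => x i = k)
    (fun i => {r | (r i : ℕ) < D}) _ fun i => uniformOn_rank_lt D i)
  unfold joinsEqual
  push_cast
  refine Finset.sum_le_sum fun i _ => ?_
  by_cases h1 : x i = k
  · by_cases h2 : Joins D x r i
    · have : r ∈ {r : Equiv.Perm (Fin N) | (r i : ℕ) < D} := h2.1
      simp [h1, h2, Set.indicator_of_mem this]
    · simp [h2]
  · simp [h1]

/-- The mean work brought by a job, on the event that its service requirement exceeds `M`. -/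
def tailMean (ν : Measure ℝ) (M : ℝ) : ℝ≥0∞ := ∫⁻ s, ENNReal.ofReal (if M < s then s else 0) ∂ν

/-- A bound for the mean of `jump`. -/
def jumpMean {N : ℕ} (ν : Measure ℝ) (D k : ℕ) (M : ℝ) (x : Fin N → ℕ) : ℝ≥0∞ :=
  (N : ℝ≥0∞)⁻¹ *
    (numAtLeast x (k + 1) + D * ENNReal.ofReal ((k + 1) * M) * numEqual x k) + tailMean ν M

theorem lintegral_jump_le {N D : ℕ} (hD : 0 < D) (k : ℕ) (M : ℝ) (ν : Measure ℝ)
    [IsProbabilityMeasure ν] (hν : ∫⁻ s, ENNReal.ofReal s ∂ν = 1) (x : Fin N → ℕ) :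
    ∫⁻ r, ∫⁻ s, ENNReal.ofReal (jump D k M x r s) ∂ν
      ∂(uniformOn (Set.univ : Set (Equiv.Perm (Fin N)))) ≤ jumpMean ν D k M x := by
  set c := ENNReal.ofReal ((k + 1) * M) with hc
  have h1 : ∀ r : Equiv.Perm (Fin N), ∫⁻ s, ENNReal.ofReal (jump D k M x r s) ∂ν ≤
      joinsAtLeast D (k + 1) x r + joinsEqual D k x r * c + tailMean ν M := by
    intro r
    calc ∫⁻ s, ENNReal.ofReal (jump D k M x r s) ∂ν
        ≤ ∫⁻ s, (joinsAtLeast D (k + 1) x r * ENNReal.ofReal s + joinsEqual D k x r * c +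
            ENNReal.ofReal (if M < s then s else 0)) ∂ν := by
          refine lintegral_mono fun s => ?_
          unfold jump
          refine ENNReal.ofReal_add_le.trans (add_le_add_left (ENNReal.ofReal_add_le.trans ?_) _)
          rw [ENNReal.ofReal_mul (Nat.cast_nonneg _), ENNReal.ofReal_mul (Nat.cast_nonneg _),
            ENNReal.ofReal_natCast, ENNReal.ofReal_natCast]
      _ = _ := by
          rw [lintegral_add_left (by fun_prop), lintegral_add_right _ measurable_const,
            lintegral_const_mul' _ _ (ENNReal.natCast_ne_top _), hν, mul_one, lintegral_const,
            measure_univ, mul_one]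
          rfl
  calc _ ≤ ∫⁻ r, ((joinsAtLeast D (k + 1) x r + joinsEqual D k x r * c) + tailMean ν M)
          ∂(uniformOn (Set.univ : Set (Equiv.Perm (Fin N)))) := lintegral_mono h1
    _ = ∫⁻ r, (joinsAtLeast D (k + 1) x r : ℝ≥0∞)
            ∂(uniformOn (Set.univ : Set (Equiv.Perm (Fin N)))) +
          (∫⁻ r, (joinsEqual D k x r : ℝ≥0∞)
            ∂(uniformOn (Set.univ : Set (Equiv.Perm (Fin N))))) * c + tailMean ν M := by
        rw [lintegral_add_right _ measurable_const, lintegral_add_left Measurable.of_discrete,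
          lintegral_mul_const' _ _ ENNReal.ofReal_ne_top, lintegral_const, measure_univ, mul_one]
    _ ≤ (N : ℝ≥0∞)⁻¹ * numAtLeast x (k + 1) + (D * (N : ℝ≥0∞)⁻¹ * numEqual x k) * c +
          tailMean ν M := by
        gcongr
        · exact lintegral_joinsAtLeast_le hD _ x
        · exact lintegral_joinsEqual_le D k x
    _ = jumpMean ν D k M x := by
        unfold jumpMean
        rw [← hc]
        ring

/-! ### The rate inequality of the stationary regime -/

/-- Service alone does not preserve the stationary law, but it agrees with the full dynamics unless
a job arrives before `s`. That event costs at most `B` times its probability. -/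
theorem IsStationary.lintegral_serveAll_le {lam : ℝ} {N : ℕ} (h : 0 < lam * N) {D : ℕ}
    {ν : Measure ℝ} [IsProbabilityMeasure ν] {P : Discipline} {law : Measure (SystemState N)}
    (hlaw : IsStationary lam D ν P law) {F : SystemState N → ℝ≥0∞} (hF : Measurable F)
    {B : ℝ≥0∞} (hB : ∀ z, F z ≤ B) {s : ℝ} (hs : 0 ≤ s) :
    ∫⁻ z, F (serveAll P s z) ∂law ≤ ∫⁻ z, F z ∂law + B * ENNReal.ofReal (lam * N * s) := by
  have := hlaw.prob
  have := isProbabilityMeasure_arrivalLaw ν h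
  set E : Set (ℕ → ArrivalData N) := (fun a => (a 0).1) ⁻¹' Set.Iic s with hE
  have hEm : MeasurableSet E := (measurable_pi_apply 0).fst measurableSet_Iic
  have hEle : arrivalLaw lam N ν E ≤ ENNReal.ofReal (lam * N * s) := by
    rw [hE, (measurePreserving_interarrival ν h 0).measure_preimage
      measurableSet_Iic.nullMeasurableSet]
    exact expMeasure_Iic_le h hs
  have hserve : Measurable fun z : SystemState N => F (serveAll P s z) :=
    hF.comp ((measurable_serveAll P).comp (measurable_const.prodMk measurable_id))
  have hind : Measurable fun q : SystemState N × (ℕ → ArrivalData N) =>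
      (E.indicator 1 q.2 : ℝ≥0∞) := (measurable_one.indicator hEm).comp measurable_snd
  calc ∫⁻ z, F (serveAll P s z) ∂law
      = ∫⁻ q, F (serveAll P s q.1) ∂(law.prod (arrivalLaw lam N ν)) :=
        (measurePreserving_fst.lintegral_comp hserve).symm
    _ ≤ ∫⁻ q, (F (stateAt P D s q.1 q.2) + B * E.indicator 1 q.2)
          ∂(law.prod (arrivalLaw lam N ν)) := by
        refine lintegral_mono fun q => ?_
        by_cases hq : q.2 ∈ E
        · rw [Set.indicator_of_mem hq, Pi.one_apply, mul_one]
          exact (hB _).trans le_add_self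
        · rw [Set.indicator_of_notMem hq, mul_zero, add_zero,
            stateAt_of_lt P D q.1 (not_le.1 hq)]
    _ = ∫⁻ z, F z ∂law + B * arrivalLaw lam N ν E := by
        rw [lintegral_add_right _ (hind.const_mul B)]
        congr 1
        · conv_rhs => rw [← hlaw.invariant s hs]
          rw [systemLaw, lintegral_map hF (measurable_stateAt P D s)]
        · rw [lintegral_const_mul _ hind]
          congr 1
          rw [measurePreserving_snd.lintegral_comp (measurable_one.indicator hEm),
            lintegral_indicator_one hEm]
    _ ≤ _ := by gcongr

theorem valid_stateAt {N : ℕ} (P : Discipline) (D : ℕ) {z : SystemState N}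
    (hz : ∀ i, (z i).Valid) {a : ℕ → ArrivalData N} (ha : ∀ m, 0 < (a m).1 ∧ 0 < (a m).2.2)
    {t : ℝ} (ht : 0 ≤ t) (i : Fin N) : (stateAt P D t z a i).Valid :=
  P.valid_serve (sub_nonneg.2 (arrivalTime_arrivalCount_le a ht)) (valid_stateAfter P D hz ha _ i)

theorem measurable_jumpMean {N : ℕ} (ν : Measure ℝ) (D k : ℕ) (M : ℝ) :
    Measurable fun z : SystemState N => jumpMean ν D k M (lengths z) :=
  (Measurable.of_discrete (f := fun x : Fin N → ℕ => jumpMean ν D k M x)).comp measurable_lengths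

theorem measurable_jump {N : ℕ} (D k : ℕ) (M : ℝ) :
    Measurable fun p : SystemState N × Equiv.Perm (Fin N) × ℝ =>
      jump D k M (lengths p.1) p.2.1 p.2.2 := by
  have h0 : ∀ f : (Fin N → ℕ) → Equiv.Perm (Fin N) → ℕ,
      Measurable fun p : SystemState N × Equiv.Perm (Fin N) × ℝ =>
        (f (lengths p.1) p.2.1 : ℝ) := by
    intro f
    have hf : Measurable fun q : (Fin N → ℕ) × Equiv.Perm (Fin N) => (f q.1 q.2 : ℝ) :=
      Measurable.of_discrete
    exact hf.comp ((measurable_lengths.comp measurable_fst).prodMk measurable_snd.fst)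
  have hs : Measurable fun p : SystemState N × Equiv.Perm (Fin N) × ℝ => p.2.2 :=
    measurable_snd.snd
  have hb : Measurable fun s : ℝ => if M < s then s else 0 :=
    Measurable.ite measurableSet_Ioi measurable_id measurable_const
  have h1 := (h0 (joinsAtLeast D (k + 1))).mul hs
  have h2 := (h0 (joinsEqual D k)).mul_const ((k + 1) * M)
  have h3 := (h1.add h2).add (hb.comp hs)
  exact h3

theorem jumpMean_le {N : ℕ} (ν : Measure ℝ) (D k : ℕ) (M : ℝ) (x : Fin N → ℕ) :
    jumpMean ν D k M x ≤
      (N : ℝ≥0∞)⁻¹ * (N + D * ENNReal.ofReal ((k + 1) * M) * N) + tailMean ν M := by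
  have h1 := numAtLeast_le x (k + 1)
  have h2 : numEqual x k ≤ N := (Nat.le_add_right _ _).trans
    ((numEqual_add_numAtLeast x k).le.trans (numAtLeast_le x k))
  unfold jumpMean
  gcongr

theorem tailMean_le_one {ν : Measure ℝ} (hν : ∫⁻ s, ENNReal.ofReal s ∂ν = 1) (M : ℝ) :
    tailMean ν M ≤ 1 := by
  rw [← hν]
  refine lintegral_mono fun s => ?_
  split_ifs with h
  · exact le_rfl
  · simp

open Classical in
theorem IsStationary.lintegral_jump_le {lam : ℝ} {N : ℕ} (h : 0 < lam * N) {D : ℕ} (hD : 0 < D)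
    {ν : Measure ℝ} [IsProbabilityMeasure ν] (hν : ∫⁻ s, ENNReal.ofReal s ∂ν = 1)
    {P : Discipline} {law : Measure (SystemState N)} (hlaw : IsStationary lam D ν P law) (k : ℕ)
    (M : ℝ) {B : ℝ≥0∞} (hB : ∀ x : Fin N → ℕ, jumpMean ν D k M x ≤ B) {t : ℝ} (ht : 0 ≤ t) :
    ∫⁻ q, (if (q.2 0).1 ≤ t then ENNReal.ofReal
        (jump D k M (lengths (serveAll P (q.2 0).1 q.1)) (q.2 0).2.1 (q.2 0).2.2) else 0)
        ∂(law.prod (arrivalLaw lam N ν)) ≤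
      ENNReal.ofReal (lam * N * t) * (∫⁻ z, jumpMean ν D k M (lengths z) ∂law +
        B * ENNReal.ofReal (lam * N * t)) := by
  have := hlaw.prob
  have := isProbabilityMeasure_arrivalLaw ν h
  have := isProbabilityMeasure_expMeasure h
  set Φ : SystemState N → ArrivalData N → ℝ≥0∞ := fun z b =>
    if b.1 ≤ t then ENNReal.ofReal (jump D k M (lengths (serveAll P b.1 z)) b.2.1 b.2.2) else 0
    with hΦ
  have hΦm : ∀ z, Measurable (Φ z) := by
    intro z
    refine Measurable.ite (measurableSet_le measurable_fst measurable_const) ?_ measurable_const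
    have : Measurable fun b : ArrivalData N => serveAll P b.1 z :=
      (measurable_serveAll P).comp (measurable_fst.prodMk measurable_const)
    exact ((measurable_jump D k M).comp (this.prodMk measurable_snd)).ennreal_ofReal
  set Ψ : SystemState N → ℝ → ℝ≥0∞ := fun z s =>
    (Set.Icc 0 t).indicator (fun s => jumpMean ν D k M (lengths (serveAll P s z))) s with hΨ
  have hΨm : Measurable (Function.uncurry Ψ) := by
    have h1 : Measurable fun p : SystemState N × ℝ =>
        jumpMean ν D k M (lengths (serveAll P p.2 p.1)) :=
      (measurable_jumpMean ν D k M).comp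
        ((measurable_serveAll P).comp (measurable_snd.prodMk measurable_fst))
    exact h1.indicator (measurable_snd measurableSet_Icc)
  -- The job is conditioned on its arrival time `s`: its ranking and size are independent of the
  -- state found, which is `serveAll P s z`. Only upper bounds are used, so `lintegral_prod_le`
  -- suffices.
  calc _ ≤ ∫⁻ z, ∫⁻ a, Φ z (a 0) ∂(arrivalLaw lam N ν) ∂law := lintegral_prod_le _
    _ = ∫⁻ z, ∫⁻ b, Φ z b ∂(jobLaw lam N ν) ∂law :=
        lintegral_congr fun z => (measurePreserving_job ν h 0).lintegral_comp (hΦm z)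
    _ ≤ ∫⁻ z, ∫⁻ s, Ψ z s ∂(expMeasure (lam * N)) ∂law := by
        refine lintegral_mono fun z => (lintegral_prod_le _).trans (lintegral_mono_ae ?_)
        filter_upwards [ae_expMeasure_pos h] with s hs
        by_cases hst : s ≤ t
        · have h1 : Ψ z s = jumpMean ν D k M (lengths (serveAll P s z)) :=
            Set.indicator_of_mem (show s ∈ Set.Icc 0 t from ⟨hs.le, hst⟩) _
          rw [h1]
          simp only [hΦ, if_pos hst]
          exact (lintegral_prod_le _).trans
            (LoadBalancing.lintegral_jump_le hD k M ν hν (lengths (serveAll P s z)))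
        · simp [hΦ, hst]
    _ = ∫⁻ s, ∫⁻ z, Ψ z s ∂law ∂(expMeasure (lam * N)) := lintegral_lintegral_swap hΨm.aemeasurable
    _ ≤ ∫⁻ s, (Set.Icc 0 t).indicator (fun _ => ∫⁻ z, jumpMean ν D k M (lengths z) ∂law +
          B * ENNReal.ofReal (lam * N * t)) s ∂(expMeasure (lam * N)) := by
        refine lintegral_mono fun s => ?_
        by_cases hs : s ∈ Set.Icc 0 t
        · simp only [hΨ, Set.indicator_of_mem hs]
          refine (hlaw.lintegral_serveAll_le h (measurable_jumpMean ν D k M) (fun z => hB _)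
            hs.1).trans ?_
          gcongr
          exact hs.2
        · simp [hΨ, Set.indicator_of_notMem hs]
    _ = (∫⁻ z, jumpMean ν D k M (lengths z) ∂law + B * ENNReal.ofReal (lam * N * t)) *
          expMeasure (lam * N) (Set.Icc 0 t) := lintegral_indicator_const measurableSet_Icc _
    _ ≤ _ := by
        rw [mul_comm]
        gcongr
        exact (measure_mono Set.Icc_subset_Iic_self).trans (expMeasure_Iic_le h ht)

/-- The pathwise inequality for the potential is integrated; by stationarity the mean potential is
the same at both times and cancels, leaving the mean decrease bounded by the mean growth. -/
theorem IsStationary.mul_lintegral_numModerate_le {lam : ℝ} {N : ℕ} (h : 0 < lam * N) {D : ℕ}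
    (hD : 0 < D) {ν : Measure ℝ} [IsProbabilityMeasure ν] (hν : ∫⁻ s, ENNReal.ofReal s ∂ν = 1)
    (hνpos : ∀ᵐ s ∂ν, 0 < s) {P : Discipline} {law : Measure (SystemState N)}
    (hlaw : IsStationary lam D ν P law) (k : ℕ) {M : ℝ} (hM : 0 ≤ M) {L : ℝ} (hL : 0 ≤ L)
    {B : ℝ≥0∞} (hB : ∀ x : Fin N → ℕ, jumpMean ν D k M x ≤ B) {t : ℝ} (ht : 0 ≤ t)
    (ht1 : t ≤ 1) :
    ENNReal.ofReal t * ∫⁻ z, (numModerate (k + 1) L z : ℝ≥0∞) ∂law ≤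
      ENNReal.ofReal (lam * N * t) * (∫⁻ z, jumpMean ν D k M (lengths z) ∂law +
        B * ENNReal.ofReal (lam * N * t)) + ENNReal.ofReal (t * N) * ENNReal.ofReal (lam * N * t) +
        ENNReal.ofReal (N * (L + 1)) * ENNReal.ofReal ((lam * N * t) ^ 2) := by
  classical
  have := hlaw.prob
  have := isProbabilityMeasure_arrivalLaw ν h
  set Q := law.prod (arrivalLaw lam N ν) with hQ
  set V : SystemState N → ℝ := systemPotential (k + 1) M (L + 1) with hV
  have hVm : Measurable V := measurable_systemPotential _ _ _
  set J : SystemState N × (ℕ → ArrivalData N) → ℝ≥0∞ := fun q =>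
    if (q.2 0).1 ≤ t then ENNReal.ofReal
      (jump D k M (lengths (serveAll P (q.2 0).1 q.1)) (q.2 0).2.1 (q.2 0).2.2) else 0 with hJ
  set E₁ : Set (ℕ → ArrivalData N) := {a | (a 0).1 ≤ t} with hE₁
  set E₂ : Set (ℕ → ArrivalData N) := {a | (a 0).1 ≤ t ∧ (a 1).1 ≤ t} with hE₂
  have hm : ∀ i, Measurable fun a : ℕ → ArrivalData N => (a i).1 := fun i =>
    (measurable_pi_apply i).fst
  have hm₁ : MeasurableSet E₁ := hm 0 measurableSet_Iic
  have hm₂ : MeasurableSet E₂ := hm₁.inter (hm 1 measurableSet_Iic)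
  have hmi : ∀ {E : Set (ℕ → ArrivalData N)}, MeasurableSet E →
      Measurable fun q : SystemState N × (ℕ → ArrivalData N) => (E.indicator 1 q.2 : ℝ≥0∞) :=
    fun hE => (measurable_one.indicator hE).comp measurable_snd
  have hint : ∀ {E : Set (ℕ → ArrivalData N)}, MeasurableSet E →
      ∫⁻ q, (E.indicator 1 q.2 : ℝ≥0∞) ∂Q = arrivalLaw lam N ν E := fun hE => by
    rw [hQ, measurePreserving_snd.lintegral_comp (measurable_one.indicator hE),
      lintegral_indicator_one hE]
  have hle₁ : arrivalLaw lam N ν E₁ ≤ ENNReal.ofReal (lam * N * t) := by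
    have : E₁ = (fun a : ℕ → ArrivalData N => (a 0).1) ⁻¹' Set.Iic t := rfl
    rw [this, (measurePreserving_interarrival ν h 0).measure_preimage
      measurableSet_Iic.nullMeasurableSet]
    exact expMeasure_Iic_le h ht
  have hle₂ : arrivalLaw lam N ν E₂ ≤ ENNReal.ofReal ((lam * N * t) ^ 2) := arrivalLaw_two_le ν h ht
  have hVfin : ∫⁻ z, ENNReal.ofReal (V z) ∂law ≠ ⊤ := by
    refine ne_top_of_le_ne_top (b := ENNReal.ofReal (N * (L + 1))) ENNReal.ofReal_ne_top ?_
    refine (lintegral_mono fun z => ENNReal.ofReal_le_ofReal (systemPotential_le _ _ _ z)).trans ?_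
    simp
  have hGm : Measurable fun z : SystemState N => (numModerate (k + 1) L z : ℝ≥0∞) :=
    (Measurable.of_discrete (f := fun m : ℕ => (m : ℝ≥0∞))).comp (measurable_numModerate _ _)
  have hpt : ∀ᵐ q ∂Q, ENNReal.ofReal (V (stateAt P D t q.1 q.2)) +
      ENNReal.ofReal t * numModerate (k + 1) L (stateAt P D t q.1 q.2) ≤
      ENNReal.ofReal (V q.1) + (J q + ENNReal.ofReal (t * N) * E₁.indicator 1 q.2 +
        ENNReal.ofReal (N * (L + 1)) * E₂.indicator 1 q.2) := by
    filter_upwards [Measure.quasiMeasurePreserving_fst.ae hlaw.valid,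
      Measure.quasiMeasurePreserving_snd.ae (ae_arrivalLaw_pos ν h hνpos)] with q hz ha
    have key := systemPotential_stateAt_le P D k hM hL hz ha ht ht1
    have hVnn : 0 ≤ V (stateAt P D t q.1 q.2) :=
      systemPotential_nonneg _ _ (by linarith) (valid_stateAt P D hz ha ht)
    rw [← ENNReal.ofReal_natCast (numModerate _ _ _), ← ENNReal.ofReal_mul ht,
      ← ENNReal.ofReal_add hVnn (by positivity)]
    refine (ENNReal.ofReal_le_ofReal key).trans (ENNReal.ofReal_add_le.trans
      (add_le_add_right (ENNReal.ofReal_add_le.trans (add_le_add ?_ ?_)) _))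
    · by_cases h0 : (q.2 0).1 ≤ t
      · have hE : q.2 ∈ E₁ := h0
        simp only [hJ, if_pos h0, Set.indicator_of_mem hE, Pi.one_apply, mul_one]
        exact ENNReal.ofReal_add_le
      · simp [h0]
    · by_cases h0 : (q.2 0).1 ≤ t ∧ (q.2 1).1 ≤ t
      · have hE : q.2 ∈ E₂ := h0
        simp only [if_pos h0, Set.indicator_of_mem hE, Pi.one_apply, mul_one, le_refl]
      · simp [h0]
  have hsum : ∫⁻ z, ENNReal.ofReal (V z) ∂law +
      ENNReal.ofReal t * ∫⁻ z, (numModerate (k + 1) L z : ℝ≥0∞) ∂law ≤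
      ∫⁻ z, ENNReal.ofReal (V z) ∂law + (∫⁻ q, J q ∂Q +
        ENNReal.ofReal (t * N) * arrivalLaw lam N ν E₁ +
        ENNReal.ofReal (N * (L + 1)) * arrivalLaw lam N ν E₂) := by
    calc _ = ∫⁻ z, (ENNReal.ofReal (V z) + ENNReal.ofReal t * numModerate (k + 1) L z) ∂law := by
          rw [lintegral_add_left hVm.ennreal_ofReal, lintegral_const_mul _ hGm]
      _ = ∫⁻ q, (ENNReal.ofReal (V (stateAt P D t q.1 q.2)) +
            ENNReal.ofReal t * numModerate (k + 1) L (stateAt P D t q.1 q.2)) ∂Q := by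
          conv_lhs => rw [← hlaw.invariant t ht]
          have hVG : Measurable fun z : SystemState N =>
              ENNReal.ofReal (V z) + ENNReal.ofReal t * numModerate (k + 1) L z :=
            hVm.ennreal_ofReal.add (hGm.const_mul _)
          rw [systemLaw, lintegral_map hVG (measurable_stateAt P D t)]
      _ ≤ _ := lintegral_mono_ae hpt
      _ = _ := by
          have hVm' : Measurable fun q : SystemState N × (ℕ → ArrivalData N) =>
            ENNReal.ofReal (V q.1) := hVm.ennreal_ofReal.comp measurable_fst
          rw [lintegral_add_left hVm',
            lintegral_add_right _ ((hmi hm₂).const_mul _),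
            lintegral_add_right _ ((hmi hm₁).const_mul _), lintegral_const_mul _ (hmi hm₁),
            lintegral_const_mul _ (hmi hm₂), hint hm₁, hint hm₂, hQ,
            measurePreserving_fst.lintegral_comp hVm.ennreal_ofReal]
  -- Cancellation requires a finite mean potential; truncation supplies it, no moment of the
  -- stationary workload being known.
  refine ((ENNReal.add_le_add_iff_left hVfin).1 hsum).trans ?_
  gcongr
  exact hlaw.lintegral_jump_le h hD hν k M hB ht

/-- After division by `t`, all errors are at most `t * C` with `C` finite for fixed `L`; then `t = 1
/ (n + 1)` tends to zero. -/
theorem IsStationary.lintegral_numModerate_le {lam : ℝ} {N : ℕ} (h : 0 < lam * N) {D : ℕ}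
    (hD : 0 < D) {ν : Measure ℝ} [IsProbabilityMeasure ν] (hν : ∫⁻ s, ENNReal.ofReal s ∂ν = 1)
    (hνpos : ∀ᵐ s ∂ν, 0 < s) {P : Discipline} {law : Measure (SystemState N)}
    (hlaw : IsStationary lam D ν P law) (k : ℕ) {M : ℝ} (hM : 0 ≤ M) {L : ℝ} (hL : 0 ≤ L) :
    ∫⁻ z, (numModerate (k + 1) L z : ℝ≥0∞) ∂law ≤
      ENNReal.ofReal (lam * N) * ∫⁻ z, jumpMean ν D k M (lengths z) ∂law := by
  have hN : (N : ℝ≥0∞) ≠ 0 := by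
    rintro h0
    rw [Nat.cast_eq_zero] at h0
    simp [h0] at h
  set B : ℝ≥0∞ := (N : ℝ≥0∞)⁻¹ * (N + D * ENNReal.ofReal ((k + 1) * M) * N) + 1 with hBdef
  have hB : ∀ x : Fin N → ℕ, jumpMean ν D k M x ≤ B := fun x =>
    (jumpMean_le ν D k M x).trans (by
      rw [hBdef]
      gcongr
      exact tailMean_le_one hν M)
  have hBtop : B ≠ ⊤ := by finiteness
  set η := ENNReal.ofReal (lam * N) with hη
  set I := ∫⁻ z, jumpMean ν D k M (lengths z) ∂law with hI
  set C : ℝ≥0∞ := η * (B * η) + N * η + ENNReal.ofReal (N * (L + 1)) * η ^ 2 with hC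
  have hCtop : C ≠ ⊤ := by finiteness
  have key : ∀ n : ℕ, ∫⁻ z, (numModerate (k + 1) L z : ℝ≥0∞) ∂law ≤
      η * I + ENNReal.ofReal (1 / ((n : ℝ) + 1)) * C := by
    intro n
    set t : ℝ := 1 / ((n : ℝ) + 1) with ht
    have ht0 : 0 < t := by positivity
    have ht1 : t ≤ 1 := by
      rw [ht, div_le_one (by positivity)]
      linarith [(Nat.cast_nonneg n : (0 : ℝ) ≤ n)]
    have h1 := hlaw.mul_lintegral_numModerate_le h hD hν hνpos k hM hL hB ht0.le ht1
    rw [ENNReal.ofReal_pow (by positivity), ENNReal.ofReal_mul h.le, ENNReal.ofReal_mul ht0.le,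
      ENNReal.ofReal_natCast, ← hη, ← hI] at h1
    refine (ENNReal.mul_le_mul_iff_right (a := ENNReal.ofReal t) ?_ ENNReal.ofReal_ne_top).1
      (h1.trans_eq ?_)
    · simpa using ht0
    · rw [hC]
      ring
  have hlim : Tendsto (fun n : ℕ => η * I + ENNReal.ofReal (1 / ((n : ℝ) + 1)) * C) atTop
      (𝓝 (η * I + ENNReal.ofReal 0 * C)) :=
    tendsto_const_nhds.add (ENNReal.Tendsto.mul_const
      (ENNReal.tendsto_ofReal tendsto_one_div_add_atTop_nhds_zero_nat) (Or.inr hCtop))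
  rw [ENNReal.ofReal_zero, zero_mul, add_zero] at hlim
  exact ge_of_tendsto' hlim key

/-- Monotone convergence removes the truncation; the bound being passed to the limit does not
involve `L`. -/
theorem tendsto_lintegral_numModerate {N : ℕ} (law : Measure (SystemState N)) (k : ℕ) :
    Tendsto (fun L : ℕ => ∫⁻ z, (numModerate k L z : ℝ≥0∞) ∂law) atTop
      (𝓝 (meanAtLeast law k)) := by
  refine lintegral_tendsto_of_tendsto_of_monotone (fun L => ?_) (ae_of_all _ fun z => ?_)
    (ae_of_all _ fun z => ?_)
  · exact ((Measurable.of_discrete (f := fun m : ℕ => (m : ℝ≥0∞))).comp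
      (measurable_numModerate _ _)).aemeasurable
  · intro L L' hL
    have hL' : (L : ℝ) ≤ L' := by exact_mod_cast hL
    refine Nat.cast_le.2 (Finset.sum_le_sum fun i _ => ?_)
    split_ifs with h1 h2 h2
    exacts [le_rfl, absurd ⟨h1.1, h1.2.trans hL'⟩ h2, zero_le_one, le_rfl]
  · obtain ⟨L₀, hL₀⟩ := exists_nat_ge (∑ i, |(z i).workload|)
    refine tendsto_atTop_of_eventually_const (i₀ := L₀) fun L hL => ?_
    have hw : ∀ i, (z i).workload ≤ L := fun i =>
      calc (z i).workload ≤ |(z i).workload| := le_abs_self _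
        _ ≤ ∑ i, |(z i).workload| := Finset.single_le_sum (f := fun i => |(z i).workload|)
            (fun i _ => abs_nonneg _) (Finset.mem_univ i)
        _ ≤ L₀ := hL₀
        _ ≤ L := by exact_mod_cast hL
    congr 1
    rw [numAtLeast_eq_sum, numModerate]
    refine Finset.sum_congr rfl fun i _ => ?_
    simp only [hw i, and_true]
    rfl

theorem IsStationary.meanAtLeast_le {lam : ℝ} {N : ℕ} (h : 0 < lam * N) {D : ℕ}
    (hD : 0 < D) {ν : Measure ℝ} [IsProbabilityMeasure ν] (hν : ∫⁻ s, ENNReal.ofReal s ∂ν = 1)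
    (hνpos : ∀ᵐ s ∂ν, 0 < s) {P : Discipline} {law : Measure (SystemState N)}
    (hlaw : IsStationary lam D ν P law) (k : ℕ) {M : ℝ} (hM : 0 ≤ M) :
    meanAtLeast law (k + 1) ≤
      ENNReal.ofReal (lam * N) * ∫⁻ z, jumpMean ν D k M (lengths z) ∂law :=
  le_of_tendsto' (tendsto_lintegral_numModerate law (k + 1)) fun L =>
    hlaw.lintegral_numModerate_le h hD hν hνpos k hM (Nat.cast_nonneg L)

theorem meanAtLeast_le_card {N : ℕ} (law : Measure (SystemState N)) [IsProbabilityMeasure law]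
    (k : ℕ) : meanAtLeast law k ≤ N :=
  (lintegral_mono fun z => Nat.cast_le.2 (numAtLeast_le (lengths z) k)).trans (by simp)

/-- The balance of work in the servers with queue length above `k`. -/
theorem IsStationary.toReal_meanAtLeast_le {lam : ℝ} {N : ℕ} (hlam : 0 < lam) (hN : 0 < N)
    {D : ℕ} (hD : 0 < D) {ν : Measure ℝ} [IsProbabilityMeasure ν]
    (hν : ∫⁻ s, ENNReal.ofReal s ∂ν = 1) (hνpos : ∀ᵐ s ∂ν, 0 < s) {P : Discipline}
    {law : Measure (SystemState N)} (hlaw : IsStationary lam D ν P law) (k : ℕ) {M : ℝ}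
    (hM : 0 ≤ M) :
    (meanAtLeast law (k + 1)).toReal ≤ lam * (meanAtLeast law (k + 1)).toReal +
      lam * D * M * (k + 1) *
        ((meanAtLeast law k).toReal - (meanAtLeast law (k + 1)).toReal) +
      lam * N * (tailMean ν M).toReal := by
  have := hlaw.prob
  have hN' : (0 : ℝ) < N := by exact_mod_cast hN
  have hfin : ∀ k, meanAtLeast law k ≠ ⊤ := fun k =>
    ne_top_of_le_ne_top (ENNReal.natCast_ne_top N) (meanAtLeast_le_card law k)
  have htail : tailMean ν M ≠ ⊤ := ne_top_of_le_ne_top ENNReal.one_ne_top (tailMean_le_one hν M)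
  have hmeas : ∀ f : (Fin N → ℕ) → ℕ, Measurable fun z : SystemState N =>
      (f (lengths z) : ℝ≥0∞) := fun f =>
    (Measurable.of_discrete (f := fun x : Fin N → ℕ => (f x : ℝ≥0∞))).comp measurable_lengths
  set E : ℝ≥0∞ := ∫⁻ z, (numEqual (lengths z) k : ℝ≥0∞) ∂law with hE
  have hEadd : E + meanAtLeast law (k + 1) = meanAtLeast law k := by
    rw [hE, meanAtLeast, ← lintegral_add_left (hmeas fun x => numEqual x k)]
    refine lintegral_congr fun z => ?_
    exact_mod_cast numEqual_add_numAtLeast (lengths z) k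
  have hEfin : E ≠ ⊤ := ne_top_of_le_ne_top (hfin k) (le_self_add.trans hEadd.le)
  have hEreal : E.toReal = (meanAtLeast law k).toReal - (meanAtLeast law (k + 1)).toReal := by
    rw [← hEadd, ENNReal.toReal_add hEfin (hfin _)]
    ring
  set c := ENNReal.ofReal ((k + 1) * M) with hc
  have hcfin : c ≠ ⊤ := ENNReal.ofReal_ne_top
  have hint : ∫⁻ z, jumpMean ν D k M (lengths z) ∂law =
      (N : ℝ≥0∞)⁻¹ * (meanAtLeast law (k + 1) + D * c * E) + tailMean ν M := by
    simp only [jumpMean]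
    have hm1 := hmeas fun x => numAtLeast x (k + 1)
    have hm2 : Measurable fun z : SystemState N =>
        (numAtLeast (lengths z) (k + 1) : ℝ≥0∞) + D * c * numEqual (lengths z) k :=
      hm1.add ((hmeas fun x => numEqual x k).const_mul (D * c))
    rw [lintegral_add_right _ measurable_const, lintegral_const_mul _ hm2,
      lintegral_add_left hm1, lintegral_const_mul _ (hmeas fun x => numEqual x k), lintegral_const,
      measure_univ, mul_one]
    rfl
  have key := hlaw.meanAtLeast_le (by positivity) hD hν hνpos k hM
  rw [hint] at key
  have hNne : (N : ℝ≥0∞)⁻¹ ≠ ⊤ := ENNReal.inv_ne_top.2 (by exact_mod_cast hN.ne')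
  have hDc : D * c * E ≠ ⊤ :=
    ENNReal.mul_ne_top (ENNReal.mul_ne_top (ENNReal.natCast_ne_top D) hcfin) hEfin
  have hsum : meanAtLeast law (k + 1) + D * c * E ≠ ⊤ := ENNReal.add_ne_top.2 ⟨hfin _, hDc⟩
  have hprod := ENNReal.mul_ne_top hNne hsum
  have key2 := ENNReal.toReal_mono (ENNReal.mul_ne_top ENNReal.ofReal_ne_top
    (ENNReal.add_ne_top.2 ⟨hprod, htail⟩)) key
  rw [ENNReal.toReal_mul, ENNReal.toReal_add hprod htail, ENNReal.toReal_mul,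
    ENNReal.toReal_add (hfin _) hDc, ENNReal.toReal_mul, ENNReal.toReal_mul, ENNReal.toReal_inv,
    ENNReal.toReal_natCast, ENNReal.toReal_natCast, hc, ENNReal.toReal_ofReal (by positivity),
    ENNReal.toReal_ofReal (by positivity), hEreal] at key2
  refine key2.trans_eq ?_
  field_simp

/-! ### Summation of the balance inequalities -/

/-- Since `a` is antitone, `a (k + 1)` may be replaced by `a n` for `k < n`. Division by `k + 1`
leaves a telescoping right side and a harmonic sum on the left. -/
theorem mul_sum_le_of_balance {a : ℕ → ℝ} (ha : Antitone a) (ha0 : ∀ k, 0 ≤ a k) {x b c : ℝ}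
    (hx : 0 ≤ x) (hb : 0 ≤ b)
    (h : ∀ k : ℕ, x * a (k + 1) ≤ b * (k + 1) * (a k - a (k + 1)) + c) (n : ℕ) :
    (x * a n - c) * ∑ k ∈ Finset.range n, 1 / ((k : ℝ) + 1) ≤ b * a 0 := by
  calc (x * a n - c) * ∑ k ∈ Finset.range n, 1 / ((k : ℝ) + 1)
      = ∑ k ∈ Finset.range n, (x * a n - c) * (1 / ((k : ℝ) + 1)) := Finset.mul_sum _ _ _
    _ ≤ ∑ k ∈ Finset.range n, b * (a k - a (k + 1)) := by
        refine Finset.sum_le_sum fun k hk => ?_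
        have h1 : x * a n ≤ x * a (k + 1) := by
          gcongr
          exact ha (Finset.mem_range.1 hk)
        have h2 : (0 : ℝ) < (k : ℝ) + 1 := by positivity
        rw [mul_one_div, div_le_iff₀ h2]
        have := h k
        linarith
    _ = b * (a 0 - a n) := by rw [← Finset.mul_sum, Finset.sum_range_sub']
    _ ≤ b * a 0 := by
        have := ha0 n
        gcongr
        linarith

theorem tendsto_tailMean {ν : Measure ℝ} (hν : ∫⁻ s, ENNReal.ofReal s ∂ν ≠ ⊤) :
    Tendsto (fun M : ℕ => tailMean ν M) atTop (𝓝 0) := by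
  have h0 : (0 : ℝ≥0∞) = ∫⁻ _ : ℝ, 0 ∂ν := by simp
  rw [h0]
  refine tendsto_lintegral_of_dominated_convergence (fun s => ENNReal.ofReal s) (fun M => ?_)
    (fun M => ae_of_all _ fun s => ?_) hν (ae_of_all _ fun s => ?_)
  · exact (Measurable.ite measurableSet_Ioi measurable_id measurable_const).ennreal_ofReal
  · change ENNReal.ofReal (if (M : ℝ) < s then s else 0) ≤ ENNReal.ofReal s
    split_ifs <;> simp
  · obtain ⟨M₀, hM₀⟩ := exists_nat_ge s
    refine tendsto_atTop_of_eventually_const (i₀ := M₀) fun M hM => ?_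
    have : s ≤ M := hM₀.trans (by exact_mod_cast hM)
    simp [this.not_gt]

theorem uniformTail_of_isStationary {lam : ℝ} (hlam : 0 < lam) (hlam1 : lam < 1) {D : ℕ}
    (hD : 0 < D) {ν : Measure ℝ} [IsProbabilityMeasure ν] (hν : ∫⁻ s, ENNReal.ofReal s ∂ν = 1)
    (hνpos : ∀ᵐ s ∂ν, 0 < s) {P : Discipline} {law : (n : ℕ) → Measure (SystemState (n + 1))}
    (hlaw : ∀ n, D ≤ n + 1 → IsStationary lam D ν P (law n)) : UniformTail law := by
  intro ε hε
  have hx : 0 < 1 - lam := by linarith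
  -- Half of the budget `(1 - lam) * ε` goes to the big jobs, the other half to the telescoped term,
  -- through the choice of `K`. Neither choice depends on `n`.
  obtain ⟨M, hM⟩ : ∃ M : ℕ, (tailMean ν M).toReal ≤ (1 - lam) * ε / 2 := by
    have hpos : 0 < ENNReal.ofReal ((1 - lam) * ε / 2) := by
      rw [ENNReal.ofReal_pos]
      positivity
    obtain ⟨M, hM⟩ := ENNReal.tendsto_atTop_zero.1
      (tendsto_tailMean (ν := ν) (by rw [hν]; exact ENNReal.one_ne_top)) _ hpos
    exact ⟨M, ENNReal.toReal_le_of_le_ofReal (by positivity) (hM M le_rfl)⟩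
  -- The harmonic sum is also made at least one, so that it is positive and can be cancelled.
  obtain ⟨K, hK1, hK⟩ := ((tendsto_atTop.1 Real.tendsto_sum_range_one_div_nat_succ_atTop
    (lam * D * M / ((1 - lam) * ε / 2))).and (tendsto_atTop.1
      Real.tendsto_sum_range_one_div_nat_succ_atTop 1)).exists
  set H := ∑ k ∈ Finset.range K, 1 / ((k : ℝ) + 1) with hH
  refine ⟨K, fun k hk => ?_⟩
  filter_upwards [eventually_ge_atTop D] with n hn
  have hst := hlaw n (by omega)
  have := hst.prob
  have hfin : ∀ k, meanAtLeast (law n) k ≠ ⊤ := fun k =>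
    ne_top_of_le_ne_top (ENNReal.natCast_ne_top (n + 1)) (meanAtLeast_le_card (law n) k)
  have hanti : Antitone fun k => (meanAtLeast (law n) k).toReal := fun i j hij =>
    ENNReal.toReal_mono (hfin i) (meanAtLeast_anti _ hij)
  have hsum := mul_sum_le_of_balance hanti (fun _ => ENNReal.toReal_nonneg) hx.le
    (b := lam * D * M) (c := lam * (n + 1 : ℕ) * (tailMean ν M).toReal) (by positivity)
    (fun k => by
      have := hst.toReal_meanAtLeast_le hlam (Nat.succ_pos n) hD hν hνpos k (Nat.cast_nonneg M)
      linarith) K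
  rw [← hH] at hsum
  have ha0 : (meanAtLeast (law n) 0).toReal ≤ (n : ℝ) + 1 := by
    have := ENNReal.toReal_mono (ENNReal.natCast_ne_top (n + 1)) (meanAtLeast_le_card (law n) 0)
    rw [ENNReal.toReal_natCast] at this
    exact_mod_cast this
  rw [div_le_iff₀ (by positivity)] at hK1
  have hn1 : (0 : ℝ) < (n : ℝ) + 1 := by positivity
  have hb : lam * D * M * (meanAtLeast (law n) 0).toReal ≤
      H * ((1 - lam) * ε / 2) * ((n : ℝ) + 1) := by
    calc _ ≤ lam * D * M * ((n : ℝ) + 1) := by gcongr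
      _ ≤ _ := by gcongr
  have hc : lam * (n + 1 : ℕ) * (tailMean ν M).toReal ≤ ((n : ℝ) + 1) * ((1 - lam) * ε / 2) := by
    push_cast
    have h1 : lam * ((n : ℝ) + 1) ≤ (n : ℝ) + 1 := mul_le_of_le_one_left hn1.le hlam1.le
    calc _ ≤ ((n : ℝ) + 1) * (tailMean ν M).toReal := by gcongr
      _ ≤ _ := by gcongr
  have hH0 : 0 < H := by linarith
  have hfinal : (1 - lam) * (meanAtLeast (law n) K).toReal ≤ (1 - lam) * (ε * ((n : ℝ) + 1)) := by
    have h1 : (1 - lam) * (meanAtLeast (law n) K).toReal -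
        lam * (n + 1 : ℕ) * (tailMean ν M).toReal ≤ (1 - lam) * ε / 2 * ((n : ℝ) + 1) := by
      refine le_of_mul_le_mul_right ((hsum.trans hb).trans_eq ?_) hH0
      ring
    linarith
  exact (meanAtLeast_anti _ hk).trans (ENNReal.le_ofReal_iff_toReal_le (hfin K) (by positivity)
    |>.2 (le_of_mul_le_mul_left hfinal hx))

end LoadBalancing

end


theorem corollary3p3 (lam : ℝ) (hlam0 : 0 < lam) (hlam1 : lam < 1) (D : ℕ) (hD : 2 ≤ D)
    (ν : Measure ℝ) [IsProbabilityMeasure ν] (hνpos : ∀ᵐ s ∂ν, 0 < s)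
    (hνint : Integrable (fun s : ℝ => s) ν) (hνmean : ∫ s, s ∂ν = 1)
    (P : LoadBalancing.Discipline) :
    -- fixed time: exchangeable initial laws, the tagged server having the same one for all `n`
    (∀ (μ : Measure LoadBalancing.QueueState)
        (init : (n : ℕ) → Measure (LoadBalancing.SystemState (n + 1))),
      (∀ n, D ≤ n + 1 →
        IsProbabilityMeasure (init n) ∧ (∀ᵐ z ∂(init n), ∀ i, (z i).Valid) ∧
          LoadBalancing.Exchangeable (init n) ∧ (init n).map (fun z => z 0) = μ) →
      ∀ t : ℝ, 0 < t →
        limsup (fun k : ℕ => limsup (fun n : ℕ =>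
            eLpNorm (fun z => LoadBalancing.taggedRate lam D k z) 2
              (LoadBalancing.systemLaw lam D ν P (init n) t)) atTop) atTop = 0 ∧
        ∀ rate : ℕ → ℝ,
          (∀ k, Tendsto (fun n : ℕ =>
            eLpNorm (fun z => LoadBalancing.taggedRate lam D k z - rate k) 2
              (LoadBalancing.systemLaw lam D ν P (init n) t)) atTop (𝓝 0)) →
          limsup (fun k : ℕ => (rate k : EReal)) atTop = 0) ∧
    -- stationary regime
    (∀ law : (n : ℕ) → Measure (LoadBalancing.SystemState (n + 1)),
      (∀ n, D ≤ n + 1 → LoadBalancing.IsStationary lam D ν P (law n)) →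
        limsup (fun k : ℕ => limsup (fun n : ℕ =>
            eLpNorm (fun z => LoadBalancing.taggedRate lam D k z) 2 (law n)) atTop) atTop = 0 ∧
        ∀ rate : ℕ → ℝ,
          (∀ k, Tendsto (fun n : ℕ =>
            eLpNorm (fun z => LoadBalancing.taggedRate lam D k z - rate k) 2 (law n))
              atTop (𝓝 0)) →
          limsup (fun k : ℕ => (rate k : EReal)) atTop = 0) := by
  have hν : ∫⁻ s, ENNReal.ofReal s ∂ν = 1 := by
    rw [← ofReal_integral_eq_lintegral_ofReal hνint (hνpos.mono fun s hs => hs.le), hνmean,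
      ENNReal.ofReal_one]
  refine ⟨fun μ init hinit t ht => ?_, fun law hlaw => ?_⟩
  · refine (LoadBalancing.uniformTail_systemLaw hlam0 D ν hνpos P μ init hinit
      ht).limsup_eq_zero hlam0 hD fun n hn => ?_
    have := (hinit n hn).1
    exact LoadBalancing.isProbabilityMeasure_systemLaw (by positivity) D ν P (init n) t
  · exact (LoadBalancing.uniformTail_of_isStationary hlam0 hlam1 (by omega) hν hνpos
      hlaw).limsup_eq_zero hlam0 hD fun n hn => (hlaw n hn).prob
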